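/- Let $(A,\Pi,\Pi^\vee,P,P^\vee)$ be the Cartan datum of a complex symmetrizable Kac–Moody algebra $\mathfrak g$ (finite index set $I$, simple roots $\alpha_i\in P$, simple coroots $\alpha_i^\vee\in P^\vee$). **Crystals.** A *(normal) crystal* is a set $\Gamma$ with maps $\mathrm{wt}:\Gamma\to P$, $\varepsilon_i,\varphi_i:\Gamma\to\mathbb Z$, $e_i,f_i:\Gamma\to\Gamma\sqcup\{0\}$ ($i\in I$) such that $\varphi_i(x)-\varepsilon_i(x)=\langle \mathrm{wt}(x),\alpha_i^\vee\rangle$; $\varepsilon_i(x)=\max\{n\in\mathbb N: e_i^n.x\ne 0\}$ and $\varphi_i(x)=\max\{n\in\mathbb N: f_i^n.x\neq 0\}$; $\mathrm{wt}(e_i.x)=\mathrm{wt}(x)+\alpha_i$ if $e_i.x\ne0$ and $\mathrm{wt}(f_i.x)=\mathrm{wt}(x)-\alpha_i$ if $f_i.x\neq0$; and $e_i.x=x'$ if and only if $f_i.x'=x$. The maps $e_i,f_i$ are the *Kashiwara operators*; a morphism commutes with all the structure maps, including $0$. The tensor product $\Gamma_1\otimes\Gamma_2$ is $\Gamma_1\times\Gamma_2$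 with $\mathrm{wt}(u\otimes v)=\mathrm{wt}(u)+\mathrm{wt}(v)$, where $e_i$ acts on $u$ if $\varphi_i(u)\ge\varepsilon_i(v)$ and on $v$ otherwise, and $f_i$ acts on $u$ if $\varphi_i(u)>\varepsilon_i(v)$ and on $v$ otherwise. The free monoid $\Gamma^*=\bigsqcup_{n\ge0}\Gamma^{\otimes n}$ is thereby a crystal. For $x\in\Gamma$, $\mathbf B(x)$ is the connected component of $x$. The category $\mathfrak g\text{-}\mathrm{Cryst}$ consists of the crystals all of whose connected components are isomorphic to some $B(\lambda)$, $\lambda\in P^+$; here $(B(\lambda))_{\lambda\in P^+}$ is the (unique) family of crystals such that $B(\lambda)$ is a highest weight crystal of highest weight $\lambda$ and every connected component of every $B(\lambda)\otimes B(\mu)$ is isomorphic to some $B(\nu)$. A *crystal monoid* is a quotient $\Gamma^*/{\sim}$, with the crystal structure inherited from $\Gamma^*$, where $\Gamma$ is a crystal and $\sim$ is a monoid congruence such that $w\sim w'$ implies that there is an isomorphism $\mathbf B(w)\cong\mathbf B(w')$ sending $w$ to $w'$. **2-monoids.** A *2-monoid* is a (strict) 2-category with a single 0-cell; it is a *(2,1)-monoid*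 if all its 2-cells are invertible. A *crystal 2-monoid* (resp. *crystal (2,1)-monoid*) is a 2-monoid (resp. (2,1)-monoid) with a crystal structure on its set of 1-cells and on its set of 2-cells such that * (CM1) the 1-cells form a crystal monoid under $\star_0$; * (CM2) the 2-cells form a crystal; * (CM3) the source and target maps $s,t$ from 2-cells to 1-cells are crystal morphisms; * (CM4) for every Kashiwara operator $k$ and 2-cells $\alpha,\beta$, $k.(\alpha\star_0\beta)$ equals $(k.\alpha)\star_0\beta$ if $k.(s(\alpha)s(\beta))=(k.s(\alpha))s(\beta)$, equals $\alpha\star_0(k.\beta)$ if $k.(s(\alpha)s(\beta))=s(\alpha)(k.s(\beta))$, and is $0$ otherwise; and, when $\alpha\star_1\beta$ is defined, $k.(\alpha\star_1\beta)$ equals $(k.\alpha)\star_1(k.\beta)$ if $k.s(\alpha)\neq0$ and is $0$ otherwise. **2-polygraphs.** A *2-polygraph* $X$ consists of sets $X_1,X_2$ and maps $s,t:X_2\to X_1^*$. It is a *crystal 2-polygraph* if $X_1$ and $X_2$ are crystals and $s,t$ are crystal morphisms. The *free 2-monoid* $X_2^*$ has the words of $X_1^*$ as 1-cells; its 2-cells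 are the finite $\star_1$-composable sequences of steps $x\alpha y$ ($x,y\in X_1^*$, $\alpha\in X_2$; empty sequences are the identities), modulo the congruence generated by $\alpha w v\star_1u'w\beta\equiv uw\beta\star_1\alpha wv'$ for $\alpha:u\Rightarrow u'$ and $\beta:v\Rightarrow v'$ in $X_2$ and $w\in X_1^*$; and $f\star_0g=(f\,s(g))\star_1(t(f)\,g)$. The *free (2,1)-monoid* $X_2^\top$ is the quotient of the free 2-monoid on $(X_1,X_2\sqcup X_2^-)$, where $X_2^-=\{\alpha^-:t(\alpha)\Rightarrow s(\alpha)\mid\alpha\in X_2\}$, by the congruence generated by $x\alpha y\star_1x\alpha^-y\equiv 1$ and $x\alpha^-y\star_1x\alpha y\equiv1$. **Theorem.** Let $X$ be a crystal 2-polygraph. Then: 1. $X_2^*$ is a crystal 2-monoid, with a crystal structure that on 1-cells is that of $X_1^*$ and for which $w\mapsto 1_w$ and the inclusion of $X_2$ into the 2-cells are crystal morphisms. 2. $X_2^\top$ is a (2,1)-monoid, and it is a crystal (2,1)-monoid, with a crystal structure that on 1-cells is that of $X_1^*$ and for which $w\mapsto1_w$, $\alpha\mapsto\alpha$ and $\alpha\mapsto\alpha^-$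 ($\alpha\in X_2$) are crystal morphisms. Moreover, if $X_1$ and $X_2$ belong to $\mathfrak g\text{-}\mathrm{Cryst}$, then in both cases the crystals of 1-cells and of 2-cells belong to $\mathfrak g\text{-}\mathrm{Cryst}$, and (CM1) holds with a generating crystal $\Gamma$ in $\mathfrak g\text{-}\mathrm{Cryst}$. -/

import Mathlib

universe u v

/-! ### Cartan data and crystals -/

/-- A Cartan datum: a symmetrizable generalized Cartan matrix `A` over a finite index set `I`,
realized by simple roots in the weight lattice `P` and simple coroots in the dual lattice `Pv`. -/
structure CartanDatum (I P Pv : Type*) [AddCommGroup P] [AddCommGroup Pv] where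
  finite_index : Finite I
  free_weight : Module.Free ℤ P
  finite_weight : Module.Finite ℤ P
  A : Matrix I I ℤ
  diag : ∀ i, A i i = 2
  offdiag_nonpos : ∀ i j, i ≠ j → A i j ≤ 0
  zero_symm : ∀ i j, A i j = 0 → A j i = 0
  symmetrizable : ∃ d : I → ℕ, (∀ i, 0 < d i) ∧ ∀ i j, (d i : ℤ) * A i j = d j * A j i
  pairing : P →ₗ[ℤ] Pv →ₗ[ℤ] ℤ
  perfect : pairing.IsPerfPair
  root : I → P
  coroot : I → Pv
  root_linearIndependent : LinearIndependent ℤ root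
  coroot_linearIndependent : LinearIndependent ℤ coroot
  pairing_root_coroot : ∀ i j, pairing (root j) (coroot i) = A i j

/-- The dominant weights `P⁺`. -/
def CartanDatum.Dominant {I P Pv : Type*} [AddCommGroup P] [AddCommGroup Pv]
    (D : CartanDatum I P Pv) : Type _ :=
  {wt : P // ∀ i, 0 ≤ D.pairing wt (D.coroot i)}

/-- The iterates of a partial map; `none` plays the role of the element `0`. -/
def partialIter {Γ : Type*} (g : Γ → Option Γ) : ℕ → Γ → Option Γ
  | 0, x => some x
  | n + 1, x => (g x).bind (partialIter g n)

/-- A (normal) crystal structure on the set `Γ`.  The value `none` of a Kashiwara operator is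
the extra element `0`.  Normality forces `ε` and `φ` to be non-negative, so they are taken with
values in `ℕ`. -/
@[ext] structure Crystal {I P Pv : Type*} [AddCommGroup P] [AddCommGroup Pv]
    (D : CartanDatum I P Pv) (Γ : Type*) where
  wt : Γ → P
  ε : I → Γ → ℕ
  φ : I → Γ → ℕ
  e : I → Γ → Option Γ
  f : I → Γ → Option Γ
  weight : ∀ i x, (φ i x : ℤ) - ε i x = D.pairing (wt x) (D.coroot i)
  eps_max : ∀ i x, IsGreatest {n : ℕ | partialIter (e i) n x ≠ none} (ε i x)
  phi_max : ∀ i x, IsGreatest {n : ℕ | partialIter (f i) n x ≠ none} (φ i x)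
  wt_e : ∀ i x y, e i x = some y → wt y = wt x + D.root i
  wt_f : ∀ i x y, f i x = some y → wt y = wt x - D.root i
  e_iff_f : ∀ i x y, e i x = some y ↔ f i y = some x

/-- Labels of the Kashiwara operators `e_i` and `f_i`. -/
inductive KashiwaraOp (I : Type*) where
  | e (i : I) : KashiwaraOp I
  | f (i : I) : KashiwaraOp I

theorem partialIter_isGreatest {Γ : Type*} (g : Γ → Option Γ) (N : Γ → ℕ)
    (h0 : ∀ x, g x = none ↔ N x = 0) (h1 : ∀ x y, g x = some y → N x = N y + 1) (x : Γ) :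
    IsGreatest {n : ℕ | partialIter g n x ≠ none} (N x) := by
  have key : ∀ n x, partialIter g n x ≠ none ↔ n ≤ N x := by
    intro n
    induction n with
    | zero => intro x; simp [partialIter]
    | succ n ih =>
      intro x
      cases hg : g x with
      | none => simp [partialIter, hg, (h0 x).1 hg]
      | some y =>
        simp only [partialIter, hg, Option.bind_some]
        rw [ih y, h1 x y hg]
        omega
  exact ⟨(key _ x).2 le_rfl, fun n hn => (key n x).1 hn⟩

theorem partialIter_steps {Γ : Type*} (g : Γ → Option Γ) (N : Γ → ℕ)
    (h : ∀ x, IsGreatest {n : ℕ | partialIter g n x ≠ none} (N x)) :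
    (∀ x, g x = none ↔ N x = 0) ∧ ∀ x y, g x = some y → N x = N y + 1 := by
  have h1 : ∀ x y, g x = some y → N x = N y + 1 := by
    intro x y hxy
    have e1 : ∀ n, partialIter g (n + 1) x = partialIter g n y := fun n => by
      simp [partialIter, hxy]
    apply le_antisymm
    · cases hN : N x with
      | zero => omega
      | succ n =>
        have h2 := (h x).1
        rw [hN, Set.mem_ofPred_eq, e1] at h2
        have := (h y).2 h2
        omega
    · apply (h x).2
      rw [Set.mem_ofPred_eq, e1]
      exact (h y).1
  refine ⟨fun x => ⟨fun hx => ?_, fun hx => ?_⟩, h1⟩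
  · cases hN : N x with
    | zero => rfl
    | succ n =>
      have h2 := (h x).1
      rw [hN] at h2
      exact absurd (by simp [partialIter, hx]) h2
  · cases hg : g x with
    | none => rfl
    | some y =>
      have := h1 x y hg
      omega

namespace Crystal

variable {I P Pv : Type*} [AddCommGroup P] [AddCommGroup Pv] {D : CartanDatum I P Pv}

/-- The action of a Kashiwara operator. -/
def act {Γ : Type*} (c : Crystal D Γ) : KashiwaraOp I → Γ → Option Γ
  | .e i => c.e i
  | .f i => c.f i

theorem e_none {Γ : Type*} (c : Crystal D Γ) (i : I) (x : Γ) : c.e i x = none ↔ c.ε i x = 0 :=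
  (partialIter_steps (c.e i) (c.ε i) (c.eps_max i)).1 x

theorem f_none {Γ : Type*} (c : Crystal D Γ) (i : I) (x : Γ) : c.f i x = none ↔ c.φ i x = 0 :=
  (partialIter_steps (c.f i) (c.φ i) (c.phi_max i)).1 x

theorem eps_e {Γ : Type*} (c : Crystal D Γ) {i : I} {x y : Γ} (h : c.e i x = some y) :
    c.ε i x = c.ε i y + 1 ∧ c.φ i y = c.φ i x + 1 :=
  ⟨(partialIter_steps (c.e i) (c.ε i) (c.eps_max i)).2 x y h,
    (partialIter_steps (c.f i) (c.φ i) (c.phi_max i)).2 y x ((c.e_iff_f i x y).1 h)⟩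

theorem phi_f {Γ : Type*} (c : Crystal D Γ) {i : I} {x y : Γ} (h : c.f i x = some y) :
    c.φ i x = c.φ i y + 1 ∧ c.ε i y = c.ε i x + 1 :=
  (c.eps_e ((c.e_iff_f i y x).2 h)).symm

/-- The tensor product of crystals. -/
def tensor {Γ Γ' : Type*} (c : Crystal D Γ) (c' : Crystal D Γ') : Crystal D (Γ × Γ') where
  wt x := c.wt x.1 + c'.wt x.2
  ε i x := c.ε i x.1 + (c'.ε i x.2 - c.φ i x.1)
  φ i x := c'.φ i x.2 + (c.φ i x.1 - c'.ε i x.2)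
  e i x :=
    if c'.ε i x.2 ≤ c.φ i x.1 then (c.e i x.1).map (fun y => (y, x.2))
    else (c'.e i x.2).map (fun y => (x.1, y))
  f i x :=
    if c'.ε i x.2 < c.φ i x.1 then (c.f i x.1).map (fun y => (y, x.2))
    else (c'.f i x.2).map (fun y => (x.1, y))
  weight i x := by
    have h1 := c.weight i x.1
    have h2 := c'.weight i x.2
    simp only [map_add, LinearMap.add_apply]
    omega
  eps_max i := by
    apply partialIter_isGreatest
    · rintro ⟨x, y⟩
      dsimp only
      split_ifs with h
      · rw [Option.map_eq_none_iff, c.e_none]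
        omega
      · rw [Option.map_eq_none_iff, c'.e_none]
        omega
    · rintro ⟨x, y⟩ z hz
      dsimp only at hz ⊢
      split_ifs at hz with h
      · obtain ⟨x', hx, rfl⟩ := Option.map_eq_some_iff.1 hz
        have := c.eps_e hx
        dsimp only
        omega
      · obtain ⟨y', hy, rfl⟩ := Option.map_eq_some_iff.1 hz
        have := c'.eps_e hy
        dsimp only
        omega
  phi_max i := by
    apply partialIter_isGreatest
    · rintro ⟨x, y⟩
      dsimp only
      split_ifs with h
      · rw [Option.map_eq_none_iff, c.f_none]
        omega
      · rw [Option.map_eq_none_iff, c'.f_none]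
        omega
    · rintro ⟨x, y⟩ z hz
      dsimp only at hz ⊢
      split_ifs at hz with h
      · obtain ⟨x', hx, rfl⟩ := Option.map_eq_some_iff.1 hz
        have := c.phi_f hx
        dsimp only
        omega
      · obtain ⟨y', hy, rfl⟩ := Option.map_eq_some_iff.1 hz
        have := c'.phi_f hy
        dsimp only
        omega
  wt_e i x z hz := by
    split_ifs at hz with h
    · obtain ⟨x', hx, rfl⟩ := Option.map_eq_some_iff.1 hz
      dsimp only
      rw [c.wt_e i _ _ hx]
      abel
    · obtain ⟨y', hy, rfl⟩ := Option.map_eq_some_iff.1 hz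
      dsimp only
      rw [c'.wt_e i _ _ hy]
      abel
  wt_f i x z hz := by
    split_ifs at hz with h
    · obtain ⟨x', hx, rfl⟩ := Option.map_eq_some_iff.1 hz
      dsimp only
      rw [c.wt_f i _ _ hx]
      abel
    · obtain ⟨y', hy, rfl⟩ := Option.map_eq_some_iff.1 hz
      dsimp only
      rw [c'.wt_f i _ _ hy]
      abel
  e_iff_f i := by
    rintro ⟨x, y⟩ ⟨x', y'⟩
    dsimp only
    constructor
    · intro hz
      split_ifs at hz with h
      · obtain ⟨a, ha, hab⟩ := Option.map_eq_some_iff.1 hz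
        cases hab
        have := c.eps_e ha
        rw [if_pos (by omega), (c.e_iff_f i _ _).1 ha]
        rfl
      · obtain ⟨a, ha, hab⟩ := Option.map_eq_some_iff.1 hz
        cases hab
        have := c'.eps_e ha
        rw [if_neg (by omega), (c'.e_iff_f i _ _).1 ha]
        rfl
    · intro hz
      split_ifs at hz with h
      · obtain ⟨a, ha, hab⟩ := Option.map_eq_some_iff.1 hz
        cases hab
        have := c.phi_f ha
        rw [if_pos (by omega), (c.e_iff_f i _ _).2 ha]
        rfl
      · obtain ⟨a, ha, hab⟩ := Option.map_eq_some_iff.1 hz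
        cases hab
        have := c'.phi_f ha
        rw [if_neg (by omega), (c'.e_iff_f i _ _).2 ha]
        rfl

/-! The crystal structure on words: the empty word is the trivial crystal `Γ^{⊗0}`, and the word
`x :: w` is `x ⊗ w`. -/

def wordWt {Γ : Type*} (c : Crystal D Γ) : List Γ → P
  | [] => 0
  | x :: w => c.wt x + c.wordWt w

def wordEps {Γ : Type*} (c : Crystal D Γ) (i : I) : List Γ → ℕ
  | [] => 0
  | x :: w => c.ε i x + (c.wordEps i w - c.φ i x)

def wordPhi {Γ : Type*} (c : Crystal D Γ) (i : I) : List Γ → ℕ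
  | [] => 0
  | x :: w => c.wordPhi i w + (c.φ i x - c.wordEps i w)

def wordE {Γ : Type*} (c : Crystal D Γ) (i : I) : List Γ → Option (List Γ)
  | [] => none
  | x :: w =>
    if c.wordEps i w ≤ c.φ i x then (c.e i x).map (fun y => y :: w)
    else (c.wordE i w).map (fun w' => x :: w')

def wordF {Γ : Type*} (c : Crystal D Γ) (i : I) : List Γ → Option (List Γ)
  | [] => none
  | x :: w =>
    if c.wordEps i w < c.φ i x then (c.f i x).map (fun y => y :: w)
    else (c.wordF i w).map (fun w' => x :: w')

theorem wordE_none {Γ : Type*} (c : Crystal D Γ) (i : I) (w : List Γ) :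
    c.wordE i w = none ↔ c.wordEps i w = 0 := by
  induction w with
  | nil => simp [wordE, wordEps]
  | cons x w ih =>
    simp only [wordE, wordEps]
    split_ifs with h
    · rw [Option.map_eq_none_iff, c.e_none]
      omega
    · rw [Option.map_eq_none_iff, ih]
      omega

theorem wordF_none {Γ : Type*} (c : Crystal D Γ) (i : I) (w : List Γ) :
    c.wordF i w = none ↔ c.wordPhi i w = 0 := by
  induction w with
  | nil => simp [wordF, wordPhi]
  | cons x w ih =>
    simp only [wordF, wordPhi]
    split_ifs with h
    · rw [Option.map_eq_none_iff, c.f_none]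
      omega
    · rw [Option.map_eq_none_iff, ih]
      omega

theorem wordE_some {Γ : Type*} (c : Crystal D Γ) (i : I) (w w' : List Γ)
    (h : c.wordE i w = some w') :
    c.wordEps i w = c.wordEps i w' + 1 ∧ c.wordPhi i w' = c.wordPhi i w + 1 ∧
      c.wordWt w' = c.wordWt w + D.root i ∧ c.wordF i w' = some w := by
  induction w generalizing w' with
  | nil => simp [wordE] at h
  | cons x w ih =>
    simp only [wordE] at h
    split_ifs at h with hc
    · obtain ⟨a, ha, rfl⟩ := Option.map_eq_some_iff.1 h
      have h1 := c.eps_e ha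
      simp only [wordEps, wordPhi, wordWt, wordF]
      refine ⟨by omega, by omega, by rw [c.wt_e i _ _ ha]; abel, ?_⟩
      rw [if_pos (by omega), (c.e_iff_f i _ _).1 ha]
      rfl
    · obtain ⟨a, ha, rfl⟩ := Option.map_eq_some_iff.1 h
      obtain ⟨h1, h2, h3, h4⟩ := ih a ha
      simp only [wordEps, wordPhi, wordWt, wordF]
      refine ⟨by omega, by omega, by rw [h3]; abel, ?_⟩
      rw [if_neg (by omega), h4]
      rfl

theorem wordF_some {Γ : Type*} (c : Crystal D Γ) (i : I) (w w' : List Γ)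
    (h : c.wordF i w = some w') : c.wordE i w' = some w := by
  induction w generalizing w' with
  | nil => simp [wordF] at h
  | cons x w ih =>
    simp only [wordF] at h
    split_ifs at h with hc
    · obtain ⟨a, ha, rfl⟩ := Option.map_eq_some_iff.1 h
      have h1 := c.phi_f ha
      simp only [wordE]
      rw [if_pos (by omega), (c.e_iff_f i _ _).2 ha]
      rfl
    · obtain ⟨a, ha, rfl⟩ := Option.map_eq_some_iff.1 h
      have h1 := ih a ha
      have h2 := c.wordE_some i _ _ h1
      simp only [wordE]
      rw [if_neg (by omega), h1]
      rfl

/-- The free crystal monoid: the crystal structure on `Γ* = ⨆ₙ Γ^{⊗n}`. -/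
def word {Γ : Type*} (c : Crystal D Γ) : Crystal D (FreeMonoid Γ) where
  wt := c.wordWt
  ε := c.wordEps
  φ := c.wordPhi
  e := c.wordE
  f := c.wordF
  weight i w := by
    change List Γ at w
    induction w with
    | nil => simp [wordEps, wordPhi, wordWt]
    | cons x w ih =>
      have h1 := c.weight i x
      simp only [wordEps, wordPhi, wordWt, map_add, LinearMap.add_apply]
      omega
  eps_max i := partialIter_isGreatest _ _ (c.wordE_none i) fun w w' h => (c.wordE_some i w w' h).1
  phi_max i := partialIter_isGreatest _ _ (c.wordF_none i) fun w w' h =>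
    (c.wordE_some i w' w (c.wordF_some i w w' h)).2.1
  wt_e i w w' h := (c.wordE_some i w w' h).2.2.1
  wt_f i w w' h := by
    rw [(c.wordE_some i w' w (c.wordF_some i w w' h)).2.2.1]
    abel
  e_iff_f i w w' := ⟨fun h => (c.wordE_some i w w' h).2.2.2, fun h => c.wordF_some i w' w h⟩

/-- A (strict) morphism of crystals: it commutes with all the structure maps, including `0`. -/
structure IsHom {Γ Γ' : Type*} (c : Crystal D Γ) (c' : Crystal D Γ') (F : Γ → Γ') : Prop where
  wt : ∀ x, c'.wt (F x) = c.wt x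
  ε : ∀ i x, c'.ε i (F x) = c.ε i x
  φ : ∀ i x, c'.φ i (F x) = c.φ i x
  e : ∀ i x, c'.e i (F x) = (c.e i x).map F
  f : ∀ i x, c'.f i (F x) = (c.f i x).map F

/-- The underlying set of the connected component `B(x)`: everything that is obtained from `x` by
successively applying Kashiwara operators. -/
def componentSet {Γ : Type*} (c : Crystal D Γ) (x : Γ) : Set Γ :=
  {y | Relation.ReflTransGen (fun a b => ∃ k, c.act k a = some b) x y}

/-- The restriction of a crystal to a set that is stable under the Kashiwara operators. -/
def restrict {Γ : Type*} (c : Crystal D Γ) (s : Set Γ)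
    (he : ∀ i, ∀ x ∈ s, ∀ y, c.e i x = some y → y ∈ s)
    (hf : ∀ i, ∀ x ∈ s, ∀ y, c.f i x = some y → y ∈ s) : Crystal D s where
  wt x := c.wt x
  ε i x := c.ε i x
  φ i x := c.φ i x
  e i x := (c.e i x).pmap Subtype.mk (he i x x.2)
  f i x := (c.f i x).pmap Subtype.mk (hf i x x.2)
  weight i x := c.weight i x
  eps_max i := by
    apply partialIter_isGreatest
    · intro x
      rw [Option.pmap_eq_none_iff, c.e_none]
    · intro x y h
      obtain ⟨a, ha, h1, rfl⟩ := Option.pmap_eq_some_iff.1 h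
      exact (c.eps_e h1).1
  phi_max i := by
    apply partialIter_isGreatest
    · intro x
      rw [Option.pmap_eq_none_iff, c.f_none]
    · intro x y h
      obtain ⟨a, ha, h1, rfl⟩ := Option.pmap_eq_some_iff.1 h
      exact (c.phi_f h1).1
  wt_e i x y h := by
    obtain ⟨a, ha, h1, rfl⟩ := Option.pmap_eq_some_iff.1 h
    exact c.wt_e i _ _ h1
  wt_f i x y h := by
    obtain ⟨a, ha, h1, rfl⟩ := Option.pmap_eq_some_iff.1 h
    exact c.wt_f i _ _ h1
  e_iff_f i x y := by
    constructor
    · intro h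
      obtain ⟨a, ha, h1, rfl⟩ := Option.pmap_eq_some_iff.1 h
      exact Option.pmap_eq_some_iff.2 ⟨x, x.2, (c.e_iff_f i _ _).1 h1, rfl⟩
    · intro h
      obtain ⟨a, ha, h1, rfl⟩ := Option.pmap_eq_some_iff.1 h
      exact Option.pmap_eq_some_iff.2 ⟨y, y.2, (c.e_iff_f i _ _).2 h1, rfl⟩

/-- The connected component `B(x)` as a crystal. -/
def component {Γ : Type*} (c : Crystal D Γ) (x : Γ) : Crystal D (c.componentSet x) :=
  c.restrict (c.componentSet x)
    (fun i _ hy _ hz => Relation.ReflTransGen.tail hy ⟨.e i, hz⟩)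
    (fun i _ hy _ hz => Relation.ReflTransGen.tail hy ⟨.f i, hz⟩)

/-- Two crystals are isomorphic. -/
def Iso {Γ Γ' : Type*} (c : Crystal D Γ) (c' : Crystal D Γ') : Prop :=
  ∃ θ : Γ ≃ Γ', IsHom c c' θ

/-- There is an isomorphism of crystals `B(x) ≅ B(x')` that sends `x` to `x'`. -/
def ComponentIso {Γ Γ' : Type*} (c : Crystal D Γ) (x : Γ) (c' : Crystal D Γ') (x' : Γ') : Prop :=
  ∃ θ : c.componentSet x ≃ c'.componentSet x', IsHom (c.component x) (c'.component x') θ ∧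
    θ ⟨x, Relation.ReflTransGen.refl⟩ = ⟨x', Relation.ReflTransGen.refl⟩

/-- A highest weight crystal of highest weight `wt`. -/
def IsHighestWeight {Γ : Type*} (c : Crystal D Γ) (wt : P) : Prop :=
  ∃! x, (∀ i, c.e i x = none) ∧ c.wt x = wt ∧
    ∀ y, Relation.ReflTransGen (fun a b => ∃ i, c.f i a = some b) x y

/-- The defining property of the family `B(λ)`, `λ ∈ P⁺`: `B(λ)` is a highest weight crystal of
highest weight `λ`, and the family is closed under tensor products. -/
structure IsClosedFamily {B : D.Dominant → Type*} (b : ∀ l, Crystal D (B l)) : Prop where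
  highestWeight : ∀ l, (b l).IsHighestWeight l.1
  closed : ∀ l m x, ∃ n, Iso (((b l).tensor (b m)).component x) (b n)

/-- Membership in the category `𝔤-Cryst`: every connected component is isomorphic to some
`B(λ)`, where `B(λ)`, `λ ∈ P⁺`, is the closed family of highest weight crystals (it is unique up
to isomorphism, and its members are countable). -/
def InGCryst {Γ : Type*} (c : Crystal D Γ) : Prop :=
  ∃ (B : D.Dominant → Type) (b : ∀ l, Crystal D (B l)), IsClosedFamily b ∧
    ∀ x, ∃ l, Iso (c.component x) (b l)

/-- Crystal congruences on the free crystal monoid `Γ*`. -/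
def IsCrystalCongruence {Γ : Type*} (c : Crystal D Γ) (r : Con (FreeMonoid Γ)) : Prop :=
  ∀ w w', r w w' → ComponentIso c.word w c.word w'

/-- The monoid `M`, with the crystal structure `cM`, is the quotient `Γ*/∼` of the free crystal
monoid on `Γ` by a crystal congruence, with the crystal structure inherited from `Γ*`. -/
def IsPresentedBy {M Γ : Type*} [Monoid M] (cM : Crystal D M) (c : Crystal D Γ) : Prop :=
  ∃ r : Con (FreeMonoid Γ), IsCrystalCongruence c r ∧
    ∃ θ : r.Quotient ≃* M, IsHom c.word cM fun w => θ (r.mk' w)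

/-- Crystal monoids. -/
def IsCrystalMonoid {M : Type u} [Monoid M] (cM : Crystal D M) : Prop :=
  ∃ (Γ : Type u) (c : Crystal D Γ), IsPresentedBy cM c

end Crystal

/-! ### 2-monoids and 2-polygraphs -/

/-- A 2-monoid: a (strict) 2-category with a single 0-cell.  The 1-cells form a monoid under
`⋆₀`; `vcomp a b h` is `a ⋆₁ b`, which is defined when the target of `a` is the source of `b`. -/
structure TwoMonoid where
  One : Type u
  [monoid : Monoid One]
  Two : Type v
  src : Two → One
  tgt : Two → One
  id : One → Two
  hcomp : Two → Two → Two
  vcomp : ∀ a b : Two, tgt a = src b → Two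
  src_id : ∀ x, src (id x) = x
  tgt_id : ∀ x, tgt (id x) = x
  src_hcomp : ∀ a b, src (hcomp a b) = src a * src b
  tgt_hcomp : ∀ a b, tgt (hcomp a b) = tgt a * tgt b
  src_vcomp : ∀ a b h, src (vcomp a b h) = src a
  tgt_vcomp : ∀ a b h, tgt (vcomp a b h) = tgt b
  id_vcomp : ∀ a, vcomp (id (src a)) a (tgt_id _) = a
  vcomp_id : ∀ a, vcomp a (id (tgt a)) (src_id _).symm = a
  vcomp_assoc : ∀ a b c hab hbc,
    vcomp (vcomp a b hab) c ((tgt_vcomp a b hab).trans hbc) =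
      vcomp a (vcomp b c hbc) (hab.trans (src_vcomp b c hbc).symm)
  one_hcomp : ∀ a, hcomp (id 1) a = a
  hcomp_one : ∀ a, hcomp a (id 1) = a
  hcomp_assoc : ∀ a b c, hcomp (hcomp a b) c = hcomp a (hcomp b c)
  id_hcomp_id : ∀ x y, hcomp (id x) (id y) = id (x * y)
  interchange : ∀ a b c d hab hcd,
    hcomp (vcomp a b hab) (vcomp c d hcd) =
      vcomp (hcomp a c) (hcomp b d) (by rw [tgt_hcomp, src_hcomp, hab, hcd])

attribute [instance] TwoMonoid.monoid

/-- A (2,1)-monoid: all the 2-cells are invertible (for `⋆₁`). -/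
def TwoMonoid.IsTwoOneMonoid (C : TwoMonoid.{u, v}) : Prop :=
  ∀ a : C.Two, ∃ (b : C.Two) (h : C.tgt a = C.src b) (h' : C.tgt b = C.src a),
    C.vcomp a b h = C.id (C.src a) ∧ C.vcomp b a h' = C.id (C.tgt a)

/-- A 2-polygraph (with one 0-cell). -/
structure TwoPolygraph where
  gen₁ : Type u
  gen₂ : Type v
  src : gen₂ → FreeMonoid gen₁
  tgt : gen₂ → FreeMonoid gen₁

namespace TwoPolygraph

/-- The rewriting step `left ⋆₀ gen ⋆₀ right`. -/
structure Step (X : TwoPolygraph.{u, v}) where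
  left : FreeMonoid X.gen₁
  gen : X.gen₂
  right : FreeMonoid X.gen₁

variable {X : TwoPolygraph.{u, v}}

def Step.src (s : X.Step) : FreeMonoid X.gen₁ := s.left * X.src s.gen * s.right

def Step.tgt (s : X.Step) : FreeMonoid X.gen₁ := s.left * X.tgt s.gen * s.right

/-- The step `x s y`. -/
def Step.whisker (x y : FreeMonoid X.gen₁) (s : X.Step) : X.Step :=
  ⟨x * s.left, s.gen, s.right * y⟩

/-- The list `L` of steps is a composable sequence with source `w`. -/
def Chain : FreeMonoid X.gen₁ → List X.Step → Prop
  | _, [] => True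
  | w, s :: L => s.src = w ∧ Chain s.tgt L

/-- The target of a composable sequence with source `w`. -/
def endpt : FreeMonoid X.gen₁ → List X.Step → FreeMonoid X.gen₁
  | w, [] => w
  | _, s :: L => endpt s.tgt L

theorem chain_append (w : FreeMonoid X.gen₁) (L M : List X.Step) :
    Chain w (L ++ M) ↔ Chain w L ∧ Chain (endpt w L) M := by
  induction L generalizing w with
  | nil => simp [Chain, endpt]
  | cons s L ih => simp [Chain, endpt, ih, and_assoc]

theorem endpt_append (w : FreeMonoid X.gen₁) (L M : List X.Step) :
    endpt w (L ++ M) = endpt (endpt w L) M := by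
  induction L generalizing w with
  | nil => simp [endpt]
  | cons s L ih => simp [endpt, ih]

theorem Step.src_whisker (x y : FreeMonoid X.gen₁) (s : X.Step) :
    (s.whisker x y).src = x * s.src * y := by
  simp [Step.src, Step.whisker, mul_assoc]

theorem Step.tgt_whisker (x y : FreeMonoid X.gen₁) (s : X.Step) :
    (s.whisker x y).tgt = x * s.tgt * y := by
  simp [Step.tgt, Step.whisker, mul_assoc]

theorem chain_whisker (x y w : FreeMonoid X.gen₁) (L : List X.Step) (h : Chain w L) :
    Chain (x * w * y) (L.map (Step.whisker x y)) := by
  induction L generalizing w with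
  | nil => trivial
  | cons s L ih =>
    refine ⟨by rw [Step.src_whisker, h.1], ?_⟩
    rw [Step.tgt_whisker]
    exact ih _ h.2

theorem endpt_whisker (x y w : FreeMonoid X.gen₁) (L : List X.Step) :
    endpt (x * w * y) (L.map (Step.whisker x y)) = x * endpt w L * y := by
  induction L generalizing w with
  | nil => rfl
  | cons s L ih =>
    simp only [List.map_cons, endpt]
    rw [Step.tgt_whisker, ih]

theorem whisker_comp (x y x' y' : FreeMonoid X.gen₁) (L : List X.Step) :
    (L.map (Step.whisker x y)).map (Step.whisker x' y') =
      L.map (Step.whisker (x' * x) (y * y')) := by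
  simp [Step.whisker, mul_assoc]

theorem whisker_one (L : List X.Step) : L.map (Step.whisker 1 1) = L := by
  have : (Step.whisker 1 1 : X.Step → X.Step) = _root_.id := by
    funext s
    simp [Step.whisker]
  simp [this]

/-- The exchange relation `αwv ⋆₁ u'wβ ≡ uwβ ⋆₁ αwv'` for generating 2-cells `α : u ⇒ u'` and
`β : v ⇒ v'`, multiplied by words `x` on the left and `y` on the right. -/
inductive Exchange (X : TwoPolygraph.{u, v}) : List X.Step → List X.Step → Prop
  | mk (x w y : FreeMonoid X.gen₁) (α β : X.gen₂) :
    Exchange X [⟨x, α, w * X.src β * y⟩, ⟨x * X.tgt α * w, β, y⟩]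
      [⟨x * X.src α * w, β, y⟩, ⟨x, α, w * X.tgt β * y⟩]

/-- Relations between parallel sequences of steps that contain the exchange relations and are
stable under multiplication by words. -/
structure Relations (X : TwoPolygraph.{u, v}) where
  rel : List X.Step → List X.Step → Prop
  exchange : ∀ L M, Exchange X L M → rel L M
  endpt_eq : ∀ L M, rel L M → ∀ w, Chain w L → Chain w M → endpt w L = endpt w M
  whisker : ∀ L M, rel L M → ∀ x y,
    rel (L.map (Step.whisker x y)) (M.map (Step.whisker x y))

/-- A finite composable sequence of rewriting steps (empty sequences, with a given source, are
allowed). -/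
@[ext] structure Seq (X : TwoPolygraph.{u, v}) where
  src : FreeMonoid X.gen₁
  steps : List X.Step
  chain : Chain src steps

namespace Seq

def tgt (a : X.Seq) : FreeMonoid X.gen₁ := endpt a.src a.steps

/-- The empty sequence on a word. -/
def id (w : FreeMonoid X.gen₁) : X.Seq := ⟨w, [], trivial⟩

/-- The `⋆₁` composition: concatenation of sequences. -/
def vcomp (a b : X.Seq) (h : a.tgt = b.src) : X.Seq :=
  ⟨a.src, a.steps ++ b.steps,
    (chain_append _ _ _).2 ⟨a.chain, by change Chain a.tgt _; rw [h]; exact b.chain⟩⟩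

/-- The sequence `x a y`. -/
def whisker (x y : FreeMonoid X.gen₁) (a : X.Seq) : X.Seq :=
  ⟨x * a.src * y, a.steps.map (Step.whisker x y), chain_whisker _ _ _ _ a.chain⟩

theorem tgt_whisker (x y : FreeMonoid X.gen₁) (a : X.Seq) :
    (a.whisker x y).tgt = x * a.tgt * y := endpt_whisker _ _ _ _

/-- The `⋆₀` composition: first the left factor acts, then the right one. -/
def hcomp (a b : X.Seq) : X.Seq :=
  vcomp (a.whisker 1 b.src) (b.whisker a.tgt 1) (by rw [tgt_whisker]; simp [whisker])

theorem tgt_vcomp (a b : X.Seq) (h : a.tgt = b.src) : (vcomp a b h).tgt = b.tgt := by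
  simp only [tgt, vcomp, endpt_append]
  rw [← h, tgt]

theorem src_hcomp (a b : X.Seq) : (hcomp a b).src = a.src * b.src := by
  simp [hcomp, vcomp, whisker]

theorem tgt_hcomp (a b : X.Seq) : (hcomp a b).tgt = a.tgt * b.tgt := by
  simp [hcomp, tgt_vcomp, tgt_whisker]

/-- One application of a relation inside a sequence. -/
def Rewrites (R : Relations X) (a b : X.Seq) : Prop :=
  a.src = b.src ∧ ∃ p L M q, R.rel L M ∧ a.steps = p ++ L ++ q ∧ b.steps = p ++ M ++ q

theorem Rewrites.tgt_eq {R : Relations X} {a b : X.Seq} (h : Rewrites R a b) :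
    a.tgt = b.tgt := by
  obtain ⟨hs, p, L, M, q, hr, ha, hb⟩ := h
  have ca := a.chain
  have cb := b.chain
  rw [ha, chain_append, chain_append] at ca
  rw [hb, chain_append, chain_append, ← hs] at cb
  simp only [tgt, ha, hb, endpt_append, ← hs]
  rw [R.endpt_eq L M hr _ ca.1.2 cb.1.2]

theorem Rewrites.whisker {R : Relations X} {a b : X.Seq} (h : Rewrites R a b)
    (x y : FreeMonoid X.gen₁) : Rewrites R (a.whisker x y) (b.whisker x y) := by
  obtain ⟨hs, p, L, M, q, hr, ha, hb⟩ := h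
  refine ⟨by simp [Seq.whisker, hs], p.map (Step.whisker x y), L.map (Step.whisker x y),
    M.map (Step.whisker x y), q.map (Step.whisker x y), R.whisker _ _ hr _ _, ?_, ?_⟩
  · simp [Seq.whisker, ha]
  · simp [Seq.whisker, hb]

theorem Rewrites.vcomp_left {R : Relations X} {a a' : X.Seq} (h : Rewrites R a a') (b : X.Seq)
    (h1 : a.tgt = b.src) (h2 : a'.tgt = b.src) : Rewrites R (vcomp a b h1) (vcomp a' b h2) := by
  obtain ⟨hs, p, L, M, q, hr, ha, hb⟩ := h
  exact ⟨hs, p, L, M, q ++ b.steps, hr, by simp [vcomp, ha], by simp [vcomp, hb]⟩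

theorem Rewrites.vcomp_right {R : Relations X} {b b' : X.Seq} (h : Rewrites R b b') (a : X.Seq)
    (h1 : a.tgt = b.src) (h2 : a.tgt = b'.src) : Rewrites R (vcomp a b h1) (vcomp a b' h2) := by
  obtain ⟨hs, p, L, M, q, hr, ha, hb⟩ := h
  exact ⟨rfl, a.steps ++ p, L, M, q, hr, by simp [vcomp, ha], by simp [vcomp, hb]⟩

end Seq

/-- 2-cells: classes of sequences under the congruence generated by the relations. -/
def Cell (R : Relations X) : Type (max u v) := Quot (Seq.Rewrites R)

namespace Cell

variable {R : Relations X}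

/-- The class of a sequence. -/
def mk (R : Relations X) (a : X.Seq) : Cell R := Quot.mk _ a

theorem sound {a b : X.Seq} (h : Seq.Rewrites R a b) : mk R a = mk R b := Quot.sound h

def src : Cell R → FreeMonoid X.gen₁ := Quot.lift Seq.src fun _ _ h => h.1

def tgt : Cell R → FreeMonoid X.gen₁ := Quot.lift Seq.tgt fun _ _ h => h.tgt_eq

def hcomp : Cell R → Cell R → Cell R :=
  Quot.lift₂ (fun a b => mk R (Seq.hcomp a b))
    (fun a b b' h => by
      refine (sound (h.whisker a.tgt 1 |>.vcomp_right (a.whisker 1 b.src)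
        (by rw [Seq.tgt_whisker]; simp [Seq.whisker])
        (by rw [Seq.tgt_whisker]; simp [Seq.whisker, h.1]))).trans ?_
      · congr 1
        simp [Seq.hcomp, Seq.vcomp, Seq.whisker, h.1])
    (fun a a' b h => by
      refine (sound (h.whisker 1 b.src |>.vcomp_left (b.whisker a.tgt 1)
        (by rw [Seq.tgt_whisker]; simp [Seq.whisker])
        (by rw [Seq.tgt_whisker]; simp [Seq.whisker, h.tgt_eq]))).trans ?_
      · congr 1
        simp [Seq.hcomp, Seq.vcomp, Seq.whisker, h.tgt_eq])

open Classical in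
/-- The `⋆₁` composition of 2-cells (with a junk value outside of composable pairs, which is never
used). -/
noncomputable def vcompTotal : Cell R → Cell R → Cell R :=
  Quot.lift₂ (fun a b => if h : a.tgt = b.src then mk R (Seq.vcomp a b h) else mk R a)
    (fun a b b' h => by
      by_cases hb : a.tgt = b.src
      · have hb' : a.tgt = b'.src := hb.trans h.1
        simp only [dif_pos hb, dif_pos hb']
        exact sound (h.vcomp_right a hb hb')
      · have hb' : ¬ a.tgt = b'.src := fun h' => hb (h'.trans h.1.symm)
        simp only [dif_neg hb, dif_neg hb'])
    (fun a a' b h => by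
      by_cases hb : a.tgt = b.src
      · have hb' : a'.tgt = b.src := h.tgt_eq.symm.trans hb
        simp only [dif_pos hb, dif_pos hb']
        exact sound (h.vcomp_left b hb hb')
      · have hb' : ¬ a'.tgt = b.src := fun h' => hb (h.tgt_eq.trans h')
        simp only [dif_neg hb, dif_neg hb']
        exact sound h)

/-- The `⋆₁` composition of composable 2-cells. -/
noncomputable def vcomp (a b : Cell R) (_ : a.tgt = b.src) : Cell R := vcompTotal a b

theorem vcomp_mk (a b : X.Seq) (h : (mk R a).tgt = (mk R b).src) :
    vcomp (mk R a) (mk R b) h = mk R (Seq.vcomp a b h) := dif_pos h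

/-- One exchange in context. -/
def Swap (L M : List X.Step) : Prop :=
  ∃ p A B q, Exchange X A B ∧ L = p ++ A ++ q ∧ M = p ++ B ++ q

theorem Swap.context {L M : List X.Step} (h : Swap L M) (p q : List X.Step) :
    Swap (p ++ L ++ q) (p ++ M ++ q) := by
  obtain ⟨p', A, B, q', h, rfl, rfl⟩ := h
  exact ⟨p ++ p', A, B, q' ++ q, h, by simp, by simp⟩

theorem swaps_context {L M : List X.Step} (h : Relation.ReflTransGen Swap L M)
    (p q : List X.Step) : Relation.ReflTransGen Swap (p ++ L ++ q) (p ++ M ++ q) := by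
  induction h with
  | refl => exact .refl
  | tail _ h ih => exact ih.tail (h.context p q)

theorem exchange_chain {A B : List X.Step} (h : Exchange X A B) (w : FreeMonoid X.gen₁)
    (hA : Chain w A) : Chain w B := by
  obtain ⟨x, z, y, α, β⟩ := h
  obtain ⟨h1, -⟩ := hA
  refine ⟨?_, ?_, trivial⟩
  · rw [← h1]; simp [Step.src, mul_assoc]
  · simp [Step.src, Step.tgt, mul_assoc]

theorem exchange_endpt {A B : List X.Step} (h : Exchange X A B) (w : FreeMonoid X.gen₁) :
    endpt w A = endpt w B := by
  obtain ⟨x, z, y, α, β⟩ := h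
  simp [endpt, Step.tgt, mul_assoc]

theorem swaps_sound {L M : List X.Step} (h : Relation.ReflTransGen Swap L M)
    (w : FreeMonoid X.gen₁) (hL : Chain w L) :
    ∃ hM : Chain w M, mk R ⟨w, L, hL⟩ = mk R ⟨w, M, hM⟩ := by
  induction h with
  | refl => exact ⟨hL, rfl⟩
  | tail _ h ih =>
    obtain ⟨h1, e1⟩ := ih
    obtain ⟨p, A, B, q, hex, rfl, rfl⟩ := h
    have h2 : Chain w (p ++ B ++ q) := by
      rw [chain_append, chain_append] at h1 ⊢
      refine ⟨⟨h1.1.1, exchange_chain hex _ h1.1.2⟩, ?_⟩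
      rw [endpt_append, ← exchange_endpt hex, ← endpt_append]
      exact h1.2
    exact ⟨h2, e1.trans (sound ⟨rfl, p, A, B, q, R.exchange _ _ hex, rfl, rfl⟩)⟩

theorem swaps_one (s : X.Step) (z : FreeMonoid X.gen₁) (L : List X.Step) (hL : Chain z L) :
    Relation.ReflTransGen Swap ([s.whisker 1 z] ++ L.map (Step.whisker s.tgt 1))
      (L.map (Step.whisker s.src 1) ++ [s.whisker 1 (endpt z L)]) := by
  induction L generalizing z with
  | nil => exact .refl
  | cons b L ih =>
    obtain ⟨rfl, h2⟩ := hL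
    have key : Swap ([s.whisker 1 b.src] ++ (b :: L).map (Step.whisker s.tgt 1))
        ([b.whisker s.src 1] ++ ([s.whisker 1 b.tgt] ++ L.map (Step.whisker s.tgt 1))) := by
      refine ⟨[], _, _, L.map (Step.whisker s.tgt 1),
        Exchange.mk s.left (s.right * b.left) b.right s.gen b.gen, ?_, ?_⟩
      · simp [Step.whisker, Step.src, Step.tgt, mul_assoc]
      · simp [Step.whisker, Step.src, Step.tgt, mul_assoc]
    refine Relation.ReflTransGen.head key ?_
    have h3 := swaps_context (ih _ h2) [b.whisker s.src 1] []
    simpa [endpt] using h3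

theorem swaps_all (w : FreeMonoid X.gen₁) (L : List X.Step) (hL : Chain w L)
    (z : FreeMonoid X.gen₁) (M : List X.Step) (hM : Chain z M) :
    Relation.ReflTransGen Swap
      (L.map (Step.whisker 1 z) ++ M.map (Step.whisker (endpt w L) 1))
      (M.map (Step.whisker w 1) ++ L.map (Step.whisker 1 (endpt z M))) := by
  induction L generalizing w with
  | nil => simpa [endpt] using Relation.ReflTransGen.refl
  | cons s L ih =>
    obtain ⟨rfl, h2⟩ := hL
    have h3 := swaps_context (ih _ h2) [s.whisker 1 z] []
    have h4 := swaps_context (swaps_one s z M hM) [] (L.map (Step.whisker 1 (endpt z M)))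
    simp only [List.append_nil, List.nil_append, List.append_assoc] at h3 h4
    simpa [endpt] using h3.trans h4

end Cell

/-- The 2-monoid with 1-cells the words, and 2-cells the sequences of rewriting steps modulo the
congruence generated by the given relations. -/
noncomputable def Relations.twoMonoid (R : Relations X) : TwoMonoid.{u, max u v} where
  One := FreeMonoid X.gen₁
  Two := Cell R
  src := Cell.src
  tgt := Cell.tgt
  id w := Cell.mk R (Seq.id w)
  hcomp := Cell.hcomp
  vcomp := Cell.vcomp
  src_id _ := rfl
  tgt_id _ := rfl
  src_hcomp := by
    rintro ⟨a⟩ ⟨b⟩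
    exact Seq.src_hcomp a b
  tgt_hcomp := by
    rintro ⟨a⟩ ⟨b⟩
    exact Seq.tgt_hcomp a b
  src_vcomp := by
    rintro ⟨a⟩ ⟨b⟩ h
    exact (congrArg Cell.src (Cell.vcomp_mk a b h)).trans rfl
  tgt_vcomp := by
    rintro ⟨a⟩ ⟨b⟩ h
    exact (congrArg Cell.tgt (Cell.vcomp_mk a b h)).trans (Seq.tgt_vcomp a b h)
  id_vcomp := by
    rintro ⟨a⟩
    refine (Cell.vcomp_mk (Seq.id a.src) a rfl).trans ?_
    rfl
  vcomp_id := by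
    rintro ⟨a⟩
    refine (Cell.vcomp_mk a (Seq.id a.tgt) rfl).trans ?_
    refine congrArg (Cell.mk R) ?_
    ext1
    · rfl
    · simp [Seq.vcomp, Seq.id]
  vcomp_assoc := by
    rintro ⟨a⟩ ⟨b⟩ ⟨c⟩ hab hbc
    have hab' : a.tgt = b.src := hab
    have hbc' : b.tgt = c.src := hbc
    have e1 : ∀ h, Cell.vcomp (Cell.vcomp (Cell.mk R a) (Cell.mk R b) hab) (Cell.mk R c) h =
        Cell.mk R (Seq.vcomp (Seq.vcomp a b hab') c ((Seq.tgt_vcomp a b hab').trans hbc')) := by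
      rw [Cell.vcomp_mk a b hab]
      exact fun h => Cell.vcomp_mk _ c h
    have e2 : ∀ h, Cell.vcomp (Cell.mk R a) (Cell.vcomp (Cell.mk R b) (Cell.mk R c) hbc) h =
        Cell.mk R (Seq.vcomp a (Seq.vcomp b c hbc') hab') := by
      rw [Cell.vcomp_mk b c hbc]
      exact fun h => Cell.vcomp_mk a _ h
    refine (e1 _).trans (Eq.trans ?_ (e2 _).symm)
    refine congrArg (Cell.mk R) ?_
    ext1
    · rfl
    · simp [Seq.vcomp]
  one_hcomp := by
    rintro ⟨a⟩
    refine congrArg (Cell.mk R) ?_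
    ext1
    · simp [Seq.hcomp, Seq.vcomp, Seq.id, Seq.whisker]
    · simp [Seq.hcomp, Seq.vcomp, Seq.id, Seq.whisker, Seq.tgt, endpt, whisker_one]
  hcomp_one := by
    rintro ⟨a⟩
    refine congrArg (Cell.mk R) ?_
    ext1
    · simp [Seq.hcomp, Seq.vcomp, Seq.id, Seq.whisker]
    · simp [Seq.hcomp, Seq.vcomp, Seq.id, Seq.whisker, whisker_one]
  hcomp_assoc := by
    rintro ⟨a⟩ ⟨b⟩ ⟨c⟩
    refine congrArg (Cell.mk R) ?_
    ext1
    · simp [Seq.src_hcomp, mul_assoc]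
    · have h1 : ∀ a b : X.Seq, (Seq.hcomp a b).steps =
          a.steps.map (Step.whisker 1 b.src) ++ b.steps.map (Step.whisker a.tgt 1) :=
        fun _ _ => rfl
      rw [h1, h1, h1, h1, Seq.tgt_hcomp, Seq.src_hcomp, List.map_append, List.map_append,
        whisker_comp, whisker_comp, whisker_comp, whisker_comp, List.append_assoc]
      simp
  id_hcomp_id x y := by
    refine congrArg (Cell.mk R) ?_
    ext1
    · simp [Seq.src_hcomp, Seq.id]
    · simp [Seq.hcomp, Seq.vcomp, Seq.id, Seq.whisker]
  interchange := by
    rintro ⟨a⟩ ⟨b⟩ ⟨c⟩ ⟨d⟩ hab hcd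
    have hab' : a.tgt = b.src := hab
    have hcd' : c.tgt = d.src := hcd
    have h1 : ∀ a b : X.Seq, (Seq.hcomp a b).steps =
        a.steps.map (Step.whisker 1 b.src) ++ b.steps.map (Step.whisker a.tgt 1) :=
      fun _ _ => rfl
    have hac : (Seq.hcomp a c).tgt = (Seq.hcomp b d).src := by
      rw [Seq.tgt_hcomp, Seq.src_hcomp, hab', hcd']
    have e1 : Cell.hcomp (Cell.vcomp (Cell.mk R a) (Cell.mk R b) hab)
        (Cell.vcomp (Cell.mk R c) (Cell.mk R d) hcd) =
        Cell.mk R (Seq.hcomp (Seq.vcomp a b hab') (Seq.vcomp c d hcd')) := by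
      rw [Cell.vcomp_mk a b hab, Cell.vcomp_mk c d hcd]
      rfl
    refine e1.trans (Eq.trans ?_ (Cell.vcomp_mk (Seq.hcomp a c) (Seq.hcomp b d) hac).symm)
    have hsw : Relation.ReflTransGen Cell.Swap
        (Seq.hcomp (Seq.vcomp a b hab') (Seq.vcomp c d hcd')).steps
        (Seq.vcomp (Seq.hcomp a c) (Seq.hcomp b d) hac).steps := by
      have h2 := Cell.swaps_context (Cell.swaps_all b.src b.steps b.chain c.src c.steps c.chain)
        (a.steps.map (Step.whisker 1 c.src)) (d.steps.map (Step.whisker b.tgt 1))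
      have e3 : (Seq.hcomp (Seq.vcomp a b hab') (Seq.vcomp c d hcd')).steps =
          a.steps.map (Step.whisker 1 c.src) ++
            (b.steps.map (Step.whisker 1 c.src) ++ c.steps.map (Step.whisker b.tgt 1)) ++
            d.steps.map (Step.whisker b.tgt 1) := by
        rw [h1, Seq.tgt_vcomp]
        simp [Seq.vcomp]
      have e4 : (Seq.vcomp (Seq.hcomp a c) (Seq.hcomp b d) hac).steps =
          a.steps.map (Step.whisker 1 c.src) ++
            (c.steps.map (Step.whisker b.src 1) ++ b.steps.map (Step.whisker 1 c.tgt)) ++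
            d.steps.map (Step.whisker b.tgt 1) := by
        change (Seq.hcomp a c).steps ++ (Seq.hcomp b d).steps = _
        rw [h1, h1, hab', hcd']
        simp
      rw [e3, e4]
      exact h2
    obtain ⟨hM, e⟩ := Cell.swaps_sound (R := R) hsw _ (Seq.chain _)
    refine e.trans (congrArg (Cell.mk R) ?_)
    ext1
    · rw [Seq.src_hcomp]
      change _ = (Seq.hcomp a c).src
      rw [Seq.src_hcomp]
      rfl
    · rfl

theorem Exchange.whisker {L M : List X.Step} (h : Exchange X L M) (x y : FreeMonoid X.gen₁) :
    Exchange X (L.map (Step.whisker x y)) (M.map (Step.whisker x y)) := by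
  obtain ⟨a, w, b, α, β⟩ := h
  have := Exchange.mk (X := X) (x * a) w (b * y) α β
  simpa [Step.whisker, mul_assoc] using this

/-- The exchange relations only. -/
def exchangeRelations (X : TwoPolygraph.{u, v}) : Relations X where
  rel := Exchange X
  exchange _ _ h := h
  endpt_eq _ _ h w _ _ := Cell.exchange_endpt h w
  whisker _ _ h x y := h.whisker x y

/-- The free 2-monoid `X₂*` generated by the 2-polygraph `X`. -/
noncomputable def free (X : TwoPolygraph.{u, v}) : TwoMonoid.{u, max u v} :=
  X.exchangeRelations.twoMonoid

/-- The 2-polygraph `X^± = (X₁, X₂ ⊔ X₂⁻)`; `Sum.inr α` is the formal inverse `α⁻` of `α`. -/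
def double (X : TwoPolygraph.{u, v}) : TwoPolygraph.{u, v} where
  gen₁ := X.gen₁
  gen₂ := X.gen₂ ⊕ X.gen₂
  src := Sum.elim X.src X.tgt
  tgt := Sum.elim X.tgt X.src

/-- The exchange relations of `X^±`, and the relations that make `xα⁻y` inverse to `xαy`. -/
inductive TopRel (X : TwoPolygraph.{u, v}) : List X.double.Step → List X.double.Step → Prop
  | exchange {L M} (h : Exchange X.double L M) : TopRel X L M
  | right_inv (x y : FreeMonoid X.double.gen₁) (α : X.gen₂) :
    TopRel X [⟨x, Sum.inl α, y⟩, ⟨x, Sum.inr α, y⟩] []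
  | left_inv (x y : FreeMonoid X.double.gen₁) (α : X.gen₂) :
    TopRel X [⟨x, Sum.inr α, y⟩, ⟨x, Sum.inl α, y⟩] []

/-- The exchange and inverse relations on `X^±`. -/
def topRelations (X : TwoPolygraph.{u, v}) : Relations X.double where
  rel := TopRel X
  exchange _ _ h := .exchange h
  endpt_eq := by
    rintro _ _ (h | ⟨x, y, α⟩ | ⟨x, y, α⟩) w hL -
    · exact Cell.exchange_endpt h w
    · exact hL.1
    · exact hL.1
  whisker := by
    rintro _ _ (h | ⟨x, y, α⟩ | ⟨x, y, α⟩) a b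
    · exact .exchange (h.whisker a b)
    · exact .right_inv (a * x) (y * b) α
    · exact .left_inv (a * x) (y * b) α

/-- The free (2,1)-monoid `X₂^⊤` generated by the 2-polygraph `X`. -/
noncomputable def freeTop (X : TwoPolygraph.{u, v}) : TwoMonoid.{u, max u v} :=
  X.topRelations.twoMonoid

/-- The 2-cell given by a generating 2-cell. -/
def Relations.gen (R : Relations X) (α : X.gen₂) : R.twoMonoid.Two :=
  Cell.mk R ⟨X.src α, [⟨1, α, 1⟩], by simp [Chain, Step.src]⟩

end TwoPolygraph

/-! ### Crystal 2-polygraphs and crystal 2-monoids -/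

section CrystalTwo

variable {I P Pv : Type*} [AddCommGroup P] [AddCommGroup Pv]

/-- A crystal 2-polygraph. -/
structure CrystalTwoPolygraph (D : CartanDatum I P Pv) extends TwoPolygraph.{u, v} where
  crystal₁ : Crystal D gen₁
  crystal₂ : Crystal D gen₂
  src_isHom : Crystal.IsHom crystal₂ crystal₁.word src
  tgt_isHom : Crystal.IsHom crystal₂ crystal₁.word tgt

/-- A crystal structure on a 2-monoid `C`, making it a crystal 2-monoid (and a crystal
(2,1)-monoid if `C` is a (2,1)-monoid). -/
structure CrystalTwoMonoid (D : CartanDatum I P Pv) (C : TwoMonoid.{u, v}) where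
  one : Crystal D C.One
  two : Crystal D C.Two
  isCrystalMonoid : one.IsCrystalMonoid
  src_isHom : Crystal.IsHom two one C.src
  tgt_isHom : Crystal.IsHom two one C.tgt
  act_hcomp_left : ∀ k a b,
    one.act k (C.src a * C.src b) = (one.act k (C.src a)).map (fun w => w * C.src b) →
      two.act k (C.hcomp a b) = (two.act k a).map (fun a' => C.hcomp a' b)
  act_hcomp_right : ∀ k a b,
    one.act k (C.src a * C.src b) = (one.act k (C.src b)).map (fun w => C.src a * w) →
      two.act k (C.hcomp a b) = (two.act k b).map (fun b' => C.hcomp a b')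
  act_hcomp_otherwise : ∀ k a b,
    one.act k (C.src a * C.src b) ≠ (one.act k (C.src a)).map (fun w => w * C.src b) →
    one.act k (C.src a * C.src b) ≠ (one.act k (C.src b)).map (fun w => C.src a * w) →
      two.act k (C.hcomp a b) = none
  act_vcomp : ∀ k a b h, one.act k (C.src a) ≠ none →
    ∃ a' b' h', two.act k a = some a' ∧ two.act k b = some b' ∧
      two.act k (C.vcomp a b h) = some (C.vcomp a' b' h')
  act_vcomp_otherwise : ∀ k a b h, one.act k (C.src a) = none →
    two.act k (C.vcomp a b h) = none

/-- All crystals that occur in the definition of a crystal 2-monoid belong to `𝔤-Cryst`. -/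
def CrystalTwoMonoid.InGCryst {D : CartanDatum I P Pv} {C : TwoMonoid.{u, v}}
    (S : CrystalTwoMonoid D C) : Prop :=
  S.one.InGCryst ∧ S.two.InGCryst ∧
    ∃ (Γ : Type u) (c : Crystal D Γ), c.InGCryst ∧ S.one.IsPresentedBy c

end CrystalTwo

/-! A Kashiwara operator must move all steps of a sequence at once. Multiplication of words is a
crystal morphism (`word_mul_isHom`), and so are the source and target maps of the polygraph. Hence
steps `xαy` form the crystal `X₁* ⊗ X₂ ⊗ X₁*`, and taking the source or the target of a step is a
morphism. An operator that does not kill the source of a composable sequence does not kill its first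
step, hence not the target of that step, which is the source of the next one, and so on. The images
are again composable (`chain_act`), and the crystal structure on sequences is pulled back along the
source map (`lift`).

This structure descends to 2-cells as soon as the relations are stable under the simultaneous action
(`IsStable`). Both sides of an exchange come from a single element of `X₁* ⊗ X₂ ⊗ X₁* ⊗ X₂ ⊗ X₁*`
through morphisms (`exchange_total`); both steps of an inverse relation come from a single step
(`topRelations_isStable`). So the two statements are instances of one construction, the second for
the polygraph with formal inverses. In (CM4), the factor of `u ⊗ v` on which an operator acts
depends only on `φ` of `u` and `ε` of `v`, and these are constant along sequences (`endpt_wt_eps`).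
Invertibility comes from reversing a sequence of steps and cancelling from the middle
(`cancel_steps`).

For `𝔤-Cryst`, a morphism out of a highest weight crystal is injective, so the source map is
injective on each connected component of `X₂`. This passes to steps, because operators preserve the
lengths of words, then to sequences and to 2-cells (`cell_src_locallyInjective`). The component of a
2-cell is therefore isomorphic to the component of its source word, and components of words are some
`B(λ)` because the family is closed under tensor products (`word_component_iso`). -/

namespace KashiwaraOp

/-- The inverse Kashiwara operator. -/
def inv {I : Type*} : KashiwaraOp I → KashiwaraOp I
  | .e i => .f i
  | .f i => .e i

end KashiwaraOp

/-! ### Morphisms, pulled-back structures and tensor products of crystals. -/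

namespace Crystal

variable {I P Pv : Type*} [AddCommGroup P] [AddCommGroup Pv] {D : CartanDatum I P Pv}

section General

variable {Γ Γ' Γ'' Γ''' : Type*} {c : Crystal D Γ} {c' : Crystal D Γ'} {c'' : Crystal D Γ''}
  {c''' : Crystal D Γ'''}

theorem act_inv (c : Crystal D Γ) {k : KashiwaraOp I} {x y : Γ} :
    c.act k x = some y ↔ c.act k.inv y = some x := by
  cases k with
  | e i => exact c.e_iff_f i x y
  | f i => exact (c.e_iff_f i y x).symm

/-- The operator `e` lowers `ε` by one and `f` lowers `φ` by one. This lets the result of an action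
on a product reveal which factor was moved. -/
theorem act_ne_self (c : Crystal D Γ) (k : KashiwaraOp I) (x : Γ) : c.act k x ≠ some x := by
  cases k with
  | e i => exact fun h => by have := c.eps_e h; omega
  | f i => exact fun h => by have := c.phi_f h; omega

/-- The crystal structure on the source of a map `p` that intertwines given operators with those of
a crystal. -/
def lift {T : Type*} (c : Crystal D Γ) (p : T → Γ) (g : KashiwaraOp I → T → Option T)
    (hg : ∀ k x, (g k x).map p = c.act k (p x))
    (hinv : ∀ i x y, g (.e i) x = some y ↔ g (.f i) y = some x) : Crystal D T where
  wt x := c.wt (p x)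
  ε i x := c.ε i (p x)
  φ i x := c.φ i (p x)
  e i := g (.e i)
  f i := g (.f i)
  weight i x := c.weight i (p x)
  eps_max i := by
    refine partialIter_isGreatest _ _ (fun x => ?_) (fun x y h => ?_)
    · rw [← c.e_none, ← Option.map_eq_none_iff (f := p), hg]; rfl
    · have := hg (.e i) x
      rw [h] at this
      exact (c.eps_e this.symm).1
  phi_max i := by
    refine partialIter_isGreatest _ _ (fun x => ?_) (fun x y h => ?_)
    · rw [← c.f_none, ← Option.map_eq_none_iff (f := p), hg]; rfl
    · have := hg (.f i) x
      rw [h] at this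
      exact (c.phi_f this.symm).1
  wt_e i x y h := by
    have := hg (.e i) x
    rw [h] at this
    exact c.wt_e i _ _ this.symm
  wt_f i x y h := by
    have := hg (.f i) x
    rw [h] at this
    exact c.wt_f i _ _ this.symm
  e_iff_f i x y := hinv i x y

theorem lift_act {T : Type*} (c : Crystal D Γ) (p : T → Γ) (g : KashiwaraOp I → T → Option T)
    (hg : ∀ k x, (g k x).map p = c.act k (p x))
    (hinv : ∀ i x y, g (.e i) x = some y ↔ g (.f i) y = some x) (k : KashiwaraOp I) :
    (c.lift p g hg hinv).act k = g k := by
  cases k <;> rfl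

/-- The weight axiom determines `φ` from `wt` and `ε`; vanishing of `e` and `f` is read off from `ε`
and `φ`; and `f` is the partial inverse of `e`. So only these three conditions need checking. -/
theorem IsHom.of_wt_eps_e {F : Γ → Γ'} (hw : ∀ x, c'.wt (F x) = c.wt x)
    (hε : ∀ i x, c'.ε i (F x) = c.ε i x)
    (he : ∀ i x y, c.e i x = some y → c'.e i (F x) = some (F y)) : IsHom c c' F := by
  have hφ : ∀ i x, c'.φ i (F x) = c.φ i x := fun i x => by
    have h1 := c.weight i x
    have h2 := c'.weight i (F x)
    rw [hw, hε] at h2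
    omega
  refine ⟨hw, hε, hφ, fun i x => ?_, fun i x => ?_⟩
  · cases h : c.e i x with
    | none => rw [c.e_none, ← hε, ← c'.e_none] at h; simpa using h
    | some y => simpa using he i x y h
  · cases h : c.f i x with
    | none => rw [c.f_none, ← hφ, ← c'.f_none] at h; simpa using h
    | some y =>
      rw [← c.e_iff_f] at h
      have := he i y x h
      rw [c'.e_iff_f] at this
      simpa using this

theorem IsHom.of_wt_eps_act {F : Γ → Γ'} (hw : ∀ x, c'.wt (F x) = c.wt x)
    (hε : ∀ i x, c'.ε i (F x) = c.ε i x)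
    (he : ∀ k x y, c.act k x = some y → c'.act k (F x) = some (F y)) : IsHom c c' F :=
  .of_wt_eps_e hw hε fun i => he (.e i)

theorem lift_isHom {T : Type*} (c : Crystal D Γ) (p : T → Γ) (g : KashiwaraOp I → T → Option T)
    (hg : ∀ k x, (g k x).map p = c.act k (p x))
    (hinv : ∀ i x y, g (.e i) x = some y ↔ g (.f i) y = some x) :
    IsHom (c.lift p g hg hinv) c p :=
  ⟨fun _ => rfl, fun _ _ => rfl, fun _ _ => rfl, fun i x => (hg (.e i) x).symm,
    fun i x => (hg (.f i) x).symm⟩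

namespace IsHom

theorem act {F : Γ → Γ'} (h : IsHom c c' F) (k : KashiwaraOp I) (x : Γ) :
    c'.act k (F x) = (c.act k x).map F := by
  cases k with
  | e i => exact h.e i x
  | f i => exact h.f i x

theorem act_some {F : Γ → Γ'} (h : IsHom c c' F) {k : KashiwaraOp I} {x y : Γ}
    (hx : c.act k x = some y) : c'.act k (F x) = some (F y) := by
  rw [h.act, hx, Option.map_some]

theorem exists_act {F : Γ → Γ'} (h : IsHom c c' F) {k : KashiwaraOp I} {x : Γ} {y : Γ'}
    (hx : c'.act k (F x) = some y) : ∃ z, c.act k x = some z ∧ F z = y := by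
  rwa [h.act, Option.map_eq_some_iff] at hx

theorem id (c : Crystal D Γ) : IsHom c c (fun x => x) :=
  .of_wt_eps_e (fun _ => rfl) (fun _ _ => rfl) fun _ _ _ h => h

theorem comp {F : Γ → Γ'} {G : Γ' → Γ''} (hG : IsHom c' c'' G) (hF : IsHom c c' F) :
    IsHom c c'' (fun x => G (F x)) :=
  .of_wt_eps_act (fun x => (hG.wt _).trans (hF.wt x)) (fun i x => (hG.ε i _).trans (hF.ε i x))
    fun _ _ _ h => hG.act_some (hF.act_some h)

theorem symm {θ : Γ ≃ Γ'} (h : IsHom c c' θ) : IsHom c' c θ.symm := by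
  refine .of_wt_eps_act (fun x => ?_) (fun i x => ?_) (fun k x y hx => ?_)
  · rw [← h.wt, θ.apply_symm_apply]
  · rw [← h.ε, θ.apply_symm_apply]
  · obtain ⟨z, hz, rfl⟩ := h.exists_act (x := θ.symm x) (by rwa [θ.apply_symm_apply])
    rwa [θ.symm_apply_apply]

theorem tensor {F : Γ → Γ'} {G : Γ'' → Γ'''} (hF : IsHom c c' F) (hG : IsHom c'' c''' G) :
    IsHom (c.tensor c'') (c'.tensor c''') (Prod.map F G) := by
  refine .of_wt_eps_e (fun x => ?_) (fun i x => ?_) (fun i x y h => ?_)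
  · simp [Crystal.tensor, hF.wt, hG.wt]
  · simp [Crystal.tensor, hF.φ, hF.ε, hG.ε]
  · simp only [Crystal.tensor, Prod.map_fst, Prod.map_snd, hF.φ, hG.ε, hF.e, hG.e] at h ⊢
    split_ifs at h ⊢ with h1
    · obtain ⟨a, ha, rfl⟩ := Option.map_eq_some_iff.1 h
      simp [ha]
    · obtain ⟨a, ha, rfl⟩ := Option.map_eq_some_iff.1 h
      simp [ha]

end IsHom

/-- The Kashiwara operator `k` acts on the left factor of `x ⊗ y`. -/
def ActsLeft (c : Crystal D Γ) (c' : Crystal D Γ') (x : Γ) (y : Γ') : KashiwaraOp I → Prop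
  | .e i => c'.ε i y ≤ c.φ i x
  | .f i => c'.ε i y < c.φ i x

theorem tensor_act_left {k : KashiwaraOp I} {x : Γ} {y : Γ'} (h : ActsLeft c c' x y k) :
    (c.tensor c').act k (x, y) = (c.act k x).map fun z => (z, y) := by
  cases k with
  | e i => exact if_pos h
  | f i => exact if_pos h

theorem tensor_act_right {k : KashiwaraOp I} {x : Γ} {y : Γ'} (h : ¬ ActsLeft c c' x y k) :
    (c.tensor c').act k (x, y) = (c'.act k y).map fun z => (x, z) := by
  cases k with
  | e i => exact if_neg h
  | f i => exact if_neg h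

/-- This transfers the choice of factor between words and the steps starting from them, and between
the two ends of a sequence. -/
theorem actsLeft_congr {x : Γ} {y : Γ'} {x' : Γ''} {y' : Γ'''} (hx : ∀ i, c.φ i x = c''.φ i x')
    (hy : ∀ i, c'.ε i y = c'''.ε i y') (k : KashiwaraOp I) :
    ActsLeft c c' x y k ↔ ActsLeft c'' c''' x' y' k := by
  cases k <;> simp [ActsLeft, hx, hy]

theorem tensor_assoc_isHom (c : Crystal D Γ) (c' : Crystal D Γ') (c'' : Crystal D Γ'') :
    IsHom ((c.tensor c').tensor c'') (c.tensor (c'.tensor c''))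
      (Equiv.prodAssoc Γ Γ' Γ'') := by
  refine .of_wt_eps_e (fun x => ?_) (fun i x => ?_) (fun i x y h => ?_)
  · simp [Crystal.tensor, add_assoc]
  · simp only [Crystal.tensor, Equiv.prodAssoc_apply]
    omega
  · obtain ⟨⟨x1, x2⟩, x3⟩ := x
    simp only [Crystal.tensor, Equiv.prodAssoc_apply] at h ⊢
    split_ifs at h with h1 h2
    · obtain ⟨a, ha, rfl⟩ := Option.map_eq_some_iff.1 h
      obtain ⟨b, hb, rfl⟩ := Option.map_eq_some_iff.1 ha
      rw [if_pos (by omega)]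
      simp [hb]
    · obtain ⟨a, ha, rfl⟩ := Option.map_eq_some_iff.1 h
      obtain ⟨b, hb, rfl⟩ := Option.map_eq_some_iff.1 ha
      rw [if_neg (by omega), if_pos (by omega)]
      simp [hb]
    · obtain ⟨a, ha, rfl⟩ := Option.map_eq_some_iff.1 h
      rw [if_neg (by omega), if_neg (by omega)]
      simp [ha]

/-- The total map of a Kashiwara operator, which fixes the elements that are sent to `0`. -/
def total (c : Crystal D Γ) (k : KashiwaraOp I) (x : Γ) : Γ := (c.act k x).getD x

theorem total_eq {k : KashiwaraOp I} {x y : Γ} (h : c.act k x = some y) : c.total k x = y := by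
  simp [total, h]

end General

/-! ### Concatenation of words as a crystal morphism. -/

section Word

variable {Γ : Type*} (c : Crystal D Γ)

theorem wordEps_wordPhi_append (i : I) (u w : List Γ) :
    c.wordEps i (u ++ w) = c.wordEps i u + (c.wordEps i w - c.wordPhi i u) ∧
      c.wordPhi i (u ++ w) = c.wordPhi i w + (c.wordPhi i u - c.wordEps i w) := by
  induction u with
  | nil => simp [wordEps, wordPhi]
  | cons x u ih =>
    simp only [List.cons_append, wordEps, wordPhi]
    omega

theorem wordWt_append (u w : List Γ) : c.wordWt (u ++ w) = c.wordWt u + c.wordWt w := by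
  induction u with
  | nil => simp [wordWt]
  | cons x u ih => simp [wordWt, ih, add_assoc]

theorem wordE_append (i : I) (u w : List Γ) :
    c.wordE i (u ++ w) = if c.wordEps i w ≤ c.wordPhi i u then (c.wordE i u).map (· ++ w)
      else (c.wordE i w).map (u ++ ·) := by
  induction u with
  | nil =>
    have h0 : c.wordPhi i [] = 0 := rfl
    by_cases h : c.wordEps i w ≤ c.wordPhi i []
    · rw [if_pos h]
      -- As `φ` of the empty word is `0`, this branch forces `ε` of `w` to be `0`, and both sides
      -- vanish.
      exact (c.wordE_none i w).2 (by omega)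
    · rw [if_neg h]
      simp
  | cons x u ih =>
    have h1 := c.wordEps_wordPhi_append i u w
    have h2 : c.wordPhi i (x :: u) = c.wordPhi i u + (c.φ i x - c.wordEps i u) := rfl
    rw [List.cons_append, wordE, wordE, ih]
    by_cases h3 : c.wordEps i (u ++ w) ≤ c.φ i x
    · rw [if_pos h3, if_pos (by omega), if_pos (by omega)]
      simp [Function.comp_def]
    · rw [if_neg h3]
      by_cases h4 : c.wordEps i w ≤ c.wordPhi i u
      · rw [if_pos h4, if_pos (by omega), if_neg (by omega)]
        simp [Function.comp_def]
      · rw [if_neg h4, if_neg (by omega)]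
        simp [Function.comp_def]

/-- The tensor rule is associative, so splitting a word at any place gives the same action as
peeling off letters one at a time. -/
theorem word_mul_isHom :
    IsHom (c.word.tensor c.word) c.word (fun p => p.1 * p.2) := by
  refine .of_wt_eps_e (fun x => ?_) (fun i x => ?_) (fun i x y h => ?_)
  · obtain ⟨u, w⟩ := x
    exact c.wordWt_append u w
  · exact (c.wordEps_wordPhi_append i x.1 x.2).1
  · refine (c.wordE_append i x.1 x.2).trans ?_
    change (if c.wordEps i x.2 ≤ c.wordPhi i x.1 then _ else _) = _ at h
    split_ifs at h ⊢ with h1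
    · obtain ⟨a, ha, rfl⟩ := Option.map_eq_some_iff.1 h
      exact Option.map_eq_some_iff.2 ⟨a, ha, rfl⟩
    · obtain ⟨a, ha, rfl⟩ := Option.map_eq_some_iff.1 h
      exact Option.map_eq_some_iff.2 ⟨a, ha, rfl⟩

theorem word_cons_isHom : IsHom (c.tensor c.word) c.word (fun p => FreeMonoid.ofList (p.1 :: p.2)) :=
  .of_wt_eps_e (fun _ => rfl) (fun _ _ => rfl) fun i x y h => by
    obtain ⟨x, w⟩ := x
    have e1 : c.wordE i (x :: w) = if c.wordEps i w ≤ c.φ i x then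
      (c.e i x).map (fun y => (y :: w : List Γ))
        else (c.wordE i w).map (fun w' => x :: w') := rfl
    refine e1.trans ?_
    change (if c.wordEps i w ≤ c.φ i x then _ else _) = _ at h
    split_ifs at h ⊢ with h1
    · obtain ⟨a, ha, rfl⟩ := Option.map_eq_some_iff.1 h
      exact Option.map_eq_some_iff.2 ⟨a, ha, rfl⟩
    · obtain ⟨a, ha, rfl⟩ := Option.map_eq_some_iff.1 h
      exact Option.map_eq_some_iff.2 ⟨a, ha, rfl⟩

/-- An operator replaces a single letter. Constancy of length later makes factorizations of words
unique inside a component. -/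
theorem length_wordE {i : I} {u w : List Γ} (h : c.wordE i u = some w) : w.length = u.length := by
  induction u generalizing w with
  | nil => simp [wordE] at h
  | cons x u ih =>
    simp only [wordE] at h
    split_ifs at h
    · obtain ⟨a, ha, rfl⟩ := Option.map_eq_some_iff.1 h
      simp
    · obtain ⟨a, ha, rfl⟩ := Option.map_eq_some_iff.1 h
      simp [ih ha]

theorem length_act {k : KashiwaraOp I} {u w : FreeMonoid Γ} (h : c.word.act k u = some w) :
    w.length = u.length := by
  cases k with
  | e i => exact c.length_wordE h
  | f i => exact (c.length_wordE (c.wordF_some i _ _ h)).symm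

theorem word_act_one (k : KashiwaraOp I) : c.word.act k 1 = none := by
  cases k <;> rfl

theorem word_act_mul_left {k : KashiwaraOp I} {u w : FreeMonoid Γ}
    (h : ActsLeft c.word c.word u w k) :
    c.word.act k (u * w) = (c.word.act k u).map fun z => z * w := by
  rw [c.word_mul_isHom.act k (u, w), tensor_act_left h, Option.map_map]
  rfl

theorem word_act_mul_right {k : KashiwaraOp I} {u w : FreeMonoid Γ}
    (h : ¬ ActsLeft c.word c.word u w k) :
    c.word.act k (u * w) = (c.word.act k w).map fun z => u * z := by
  rw [c.word_mul_isHom.act k (u, w), tensor_act_right h, Option.map_map]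
  rfl

end Word

end Crystal

theorem FreeMonoid.mul_inj_of_length {Γ : Type*} {u w u' w' : FreeMonoid Γ}
    (hl : u.length = u'.length) (h : u * w = u' * w') : u = u' ∧ w = w' :=
  List.append_inj h hl
-- The crystal of rewriting steps.
namespace TwoPolygraph

variable {X : TwoPolygraph.{u, v}}

/-- Steps as triples. -/
def Step.equivProd (X : TwoPolygraph.{u, v}) :
    X.Step ≃ FreeMonoid X.gen₁ × X.gen₂ × FreeMonoid X.gen₁ where
  toFun s := (s.left, s.gen, s.right)
  invFun p := ⟨p.1, p.2.1, p.2.2⟩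
  left_inv _ := rfl
  right_inv _ := rfl

end TwoPolygraph

namespace CrystalTwoPolygraph

open TwoPolygraph Crystal

variable {I P Pv : Type*} [AddCommGroup P] [AddCommGroup Pv] {D : CartanDatum I P Pv}
variable (Y : CrystalTwoPolygraph.{u, v} D)

/-- The crystal of words. -/
abbrev words : Crystal D (FreeMonoid Y.gen₁) := Y.crystal₁.word

/-- The crystal structure on rewriting steps. -/
def step : Crystal D Y.Step :=
  (Y.words.tensor (Y.crystal₂.tensor Y.words)).lift (Step.equivProd Y.toTwoPolygraph)
    (fun k s => ((Y.words.tensor (Y.crystal₂.tensor Y.words)).act k (Step.equivProd _ s)).map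
      (Step.equivProd _).symm)
    (fun k s => by simp [Option.map_map])
    (fun i s t => by
      have := (Y.words.tensor (Y.crystal₂.tensor Y.words)).e_iff_f i
        (Step.equivProd _ s) (Step.equivProd _ t)
      simpa [Option.map_eq_some_iff, Equiv.symm_apply_eq, act] using this)

theorem step_equivProd_isHom : IsHom Y.step (Y.words.tensor (Y.crystal₂.tensor Y.words))
    (Step.equivProd Y.toTwoPolygraph) :=
  lift_isHom ..

theorem step_mk_isHom : IsHom (Y.words.tensor (Y.crystal₂.tensor Y.words)) Y.step
    (Step.equivProd Y.toTwoPolygraph).symm :=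
  Y.step_equivProd_isHom.symm

/-- A composite of `F` in the middle factor with two multiplications of words. Keeping `F` general
treats source and target together. -/
theorem step_map_isHom {F : Y.gen₂ → FreeMonoid Y.gen₁} (hF : IsHom Y.crystal₂ Y.words F) :
    IsHom Y.step Y.words (fun s => s.left * F s.gen * s.right) := by
  have h := Y.crystal₁.word_mul_isHom.comp
    ((IsHom.id Y.words).tensor (Y.crystal₁.word_mul_isHom.comp (hF.tensor (IsHom.id Y.words))))
  have h2 := h.comp Y.step_equivProd_isHom
  convert h2 using 2
  simp [Step.equivProd, mul_assoc]

theorem step_src_isHom : IsHom Y.step Y.words Step.src := Y.step_map_isHom Y.src_isHom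

theorem step_tgt_isHom : IsHom Y.step Y.words Step.tgt := Y.step_map_isHom Y.tgt_isHom

theorem mul_left_isHom {Γ : Type*} (c : Crystal D Γ) :
    IsHom (Y.words.tensor (Y.words.tensor c)) (Y.words.tensor c)
      (fun p => (p.1 * p.2.1, p.2.2)) :=
  (Y.crystal₁.word_mul_isHom.tensor (IsHom.id c)).comp (tensor_assoc_isHom _ _ _).symm

/-- Whiskering is reassociation of tensor factors followed by multiplication of words, both of which
are morphisms. -/
theorem whisker_left_isHom :
    IsHom (Y.words.tensor Y.step) Y.step (fun p => p.2.whisker p.1 1) := by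
  have h := Y.step_mk_isHom.comp ((Y.mul_left_isHom (Y.crystal₂.tensor Y.words)).comp
    ((IsHom.id Y.words).tensor Y.step_equivProd_isHom))
  convert h using 2
  simp [Step.equivProd, Step.whisker]

theorem whisker_right_isHom :
    IsHom (Y.step.tensor Y.words) Y.step (fun p => p.1.whisker 1 p.2) := by
  have h := Y.step_mk_isHom.comp (((IsHom.id Y.words).tensor
    (((IsHom.id Y.crystal₂).tensor Y.crystal₁.word_mul_isHom).comp
      (tensor_assoc_isHom _ _ _))).comp ((tensor_assoc_isHom _ _ _).comp
        (Y.step_equivProd_isHom.tensor (IsHom.id Y.words))))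
  convert h using 2
  simp [Step.equivProd, Step.whisker]

/-- The crystal of pairs of disjoint generating 2-cells in context. -/
abbrev exchangeCrystal : Crystal D (FreeMonoid Y.gen₁ × Y.gen₂ × FreeMonoid Y.gen₁ ×
    Y.gen₂ × FreeMonoid Y.gen₁) :=
  Y.words.tensor (Y.crystal₂.tensor (Y.words.tensor (Y.crystal₂.tensor Y.words)))

/-- Together with `exchange_snd_isHom`, and with `F` the source or the target map, this yields all
four steps of an exchange from one element of `exchangeCrystal`. -/
theorem exchange_fst_isHom {F : Y.gen₂ → FreeMonoid Y.gen₁} (hF : IsHom Y.crystal₂ Y.words F) :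
    IsHom Y.exchangeCrystal Y.step
      (fun p => ⟨p.1, p.2.1, p.2.2.1 * F p.2.2.2.1 * p.2.2.2.2⟩) := by
  have h := Y.step_mk_isHom.comp ((IsHom.id Y.words).tensor ((IsHom.id Y.crystal₂).tensor
    (Y.step_map_isHom hF |>.comp Y.step_mk_isHom)))
  exact h

theorem exchange_snd_isHom {F : Y.gen₂ → FreeMonoid Y.gen₁} (hF : IsHom Y.crystal₂ Y.words F) :
    IsHom Y.exchangeCrystal Y.step
      (fun p => ⟨p.1 * F p.2.1 * p.2.2.1, p.2.2.2.1, p.2.2.2.2⟩) := by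
  have h1 := (Y.mul_left_isHom (Y.words.tensor (Y.crystal₂.tensor Y.words))).comp
    ((IsHom.id Y.words).tensor (hF.tensor
      (IsHom.id (Y.words.tensor (Y.crystal₂.tensor Y.words)))))
  exact Y.step_mk_isHom.comp ((Y.mul_left_isHom _).comp h1)

/-! ### Simultaneous action on the steps of a sequence. -/

section Act

variable {Y} {k : KashiwaraOp I} {w w' : FreeMonoid Y.gen₁}

/-- The source map is a morphism, so it reflects nonvanishing; here `total` is therefore the genuine
action and not its default value. -/
theorem step_act {s : Y.Step} (h : Y.words.act k s.src = some w') :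
    Y.step.act k s = some (Y.step.total k s) ∧ (Y.step.total k s).src = w' := by
  obtain ⟨t, ht, e⟩ := Y.step_src_isHom.exists_act h
  rw [total_eq ht]
  exact ⟨ht, e⟩

theorem step_act_tgt {s : Y.Step} (h : Y.words.act k s.src = some w') :
    Y.words.act k s.tgt = some (Y.step.total k s).tgt :=
  Y.step_tgt_isHom.act_some (step_act h).1

/-- Nonvanishing passes from the source of a step to its target, which is the source of the next
step. -/
theorem chain_act (h : Y.words.act k w = some w') {L : List Y.Step} (hL : Chain w L) :
    Chain w' (L.map (Y.step.total k)) := by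
  induction L generalizing w w' with
  | nil => trivial
  | cons s L ih =>
    obtain ⟨rfl, h2⟩ := hL
    exact ⟨(step_act h).2, ih (step_act_tgt h) h2⟩

theorem endpt_act (h : Y.words.act k w = some w') {L : List Y.Step} (hL : Chain w L) :
    Y.words.act k (endpt w L) = some (endpt w' (L.map (Y.step.total k))) := by
  induction L generalizing w w' with
  | nil => exact h
  | cons s L ih =>
    obtain ⟨rfl, h2⟩ := hL
    exact ih (step_act_tgt h) h2

theorem map_total_inv (h : Y.words.act k w = some w') {L : List Y.Step} (hL : Chain w L) :
    (L.map (Y.step.total k)).map (Y.step.total k.inv) = L := by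
  induction L generalizing w w' with
  | nil => rfl
  | cons s L ih =>
    obtain ⟨rfl, h2⟩ := hL
    simp only [List.map_cons]
    rw [ih (step_act_tgt h) h2, total_eq (Y.step.act_inv.1 (step_act h).1)]

/-- The source and target of a step both share the `wt`, `ε` and `φ` of the step. -/
theorem endpt_wt_eps {L : List Y.Step} (hL : Chain w L) :
    Y.words.wt (endpt w L) = Y.words.wt w ∧ (∀ i, Y.words.ε i (endpt w L) = Y.words.ε i w) ∧
      ∀ i, Y.words.φ i (endpt w L) = Y.words.φ i w := by
  induction L generalizing w with
  | nil => exact ⟨rfl, fun _ => rfl, fun _ => rfl⟩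
  | cons s L ih =>
    obtain ⟨rfl, h2⟩ := hL
    obtain ⟨e1, e2, e3⟩ := ih h2
    exact ⟨(e1.trans (Y.step_tgt_isHom.wt s)).trans (Y.step_src_isHom.wt s).symm,
      fun i => ((e2 i).trans (Y.step_tgt_isHom.ε i s)).trans (Y.step_src_isHom.ε i s).symm,
      fun i => ((e3 i).trans (Y.step_tgt_isHom.φ i s)).trans (Y.step_src_isHom.φ i s).symm⟩

end Act

/-- The action of a Kashiwara operator on all steps of a sequence. -/
def seqAct (k : KashiwaraOp I) (a : Y.Seq) : Option Y.Seq :=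
  (Y.words.act k a.src).pmap
    (fun w h => ⟨w, a.steps.map (Y.step.total k), chain_act h a.chain⟩) fun _ h => h

variable {Y}

theorem seqAct_eq_some {k : KashiwaraOp I} {a b : Y.Seq} :
    Y.seqAct k a = some b ↔
      Y.words.act k a.src = some b.src ∧ b.steps = a.steps.map (Y.step.total k) := by
  rw [seqAct, Option.pmap_eq_some_iff]
  constructor
  · rintro ⟨w, h, h1, rfl⟩
    exact ⟨h1, rfl⟩
  · rintro ⟨h1, h2⟩
    exact ⟨_, h1, h1, by ext1 <;> simp [h2]⟩

theorem seqAct_src (k : KashiwaraOp I) (a : Y.Seq) :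
    (Y.seqAct k a).map Seq.src = Y.words.act k a.src := by
  simp [seqAct, Option.map_pmap]

theorem seqAct_inv {k : KashiwaraOp I} {a b : Y.Seq} (h : Y.seqAct k a = some b) :
    Y.seqAct k.inv b = some a := by
  rw [seqAct_eq_some] at h ⊢
  refine ⟨Y.words.act_inv.1 h.1, ?_⟩
  rw [h.2, map_total_inv h.1 a.chain]

theorem seqAct_tgt {k : KashiwaraOp I} {a b : Y.Seq} (h : Y.seqAct k a = some b) :
    Y.words.act k a.tgt = some b.tgt := by
  rw [seqAct_eq_some] at h
  rw [Seq.tgt, Seq.tgt, h.2]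
  exact endpt_act h.1 a.chain

theorem chain_mem_eps_phi {w : FreeMonoid Y.gen₁} {L : List Y.Step} (hL : Chain w L) {s : Y.Step}
    (hs : s ∈ L) : (∀ i, Y.step.ε i s = Y.words.ε i w) ∧ ∀ i, Y.step.φ i s = Y.words.φ i w := by
  obtain ⟨p, q, rfl⟩ := List.append_of_mem hs
  rw [chain_append] at hL
  obtain ⟨-, e1, e2⟩ := endpt_wt_eps hL.1
  obtain ⟨h, -⟩ := hL.2
  simp only [← e1, ← e2, ← h]
  exact ⟨fun i => (Y.step_src_isHom.ε i s).symm, fun i => (Y.step_src_isHom.φ i s).symm⟩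

theorem chain_mem_act {k : KashiwaraOp I} {w w' : FreeMonoid Y.gen₁}
    (h : Y.words.act k w = some w') {L : List Y.Step} (hL : Chain w L) {s : Y.Step}
    (hs : s ∈ L) : Y.step.act k s = some (Y.step.total k s) := by
  obtain ⟨p, q, rfl⟩ := List.append_of_mem hs
  rw [chain_append] at hL
  have h1 := endpt_act h hL.1
  rw [← hL.2.1] at h1
  exact (step_act h1).1

/-! ### Compatibility with whiskering and with the two compositions. -/

section Whisker

variable {k : KashiwaraOp I} {w w' z z' : FreeMonoid Y.gen₁} {L : List Y.Step}

/-- All steps of the sequence have the `ε` and `φ` of its source, so the tensor rule selects the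
same side for each whiskered step. This lemma and the next three treat the two whiskerings and the
two sides. -/
theorem map_total_whisker_right (h : Y.words.act k w = some w') (hL : Chain w L)
    (hk : ActsLeft Y.words Y.words w z k) :
    (L.map (Step.whisker 1 z)).map (Y.step.total k) =
      (L.map (Y.step.total k)).map (Step.whisker 1 z) := by
  rw [List.map_map, List.map_map]
  refine List.map_congr_left fun s hs => total_eq ?_
  have h1 : ActsLeft Y.step Y.words s z k :=
    (actsLeft_congr (chain_mem_eps_phi hL hs).2 (fun _ => rfl) k).2 hk
  exact Y.whisker_right_isHom.act_some (x := (s, z)) (y := (Y.step.total k s, z))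
    (by rw [tensor_act_left h1, chain_mem_act h hL hs]; rfl)

theorem map_total_whisker_right_of_not (h : Y.words.act k z = some z') (hL : Chain w L)
    (hk : ¬ ActsLeft Y.words Y.words w z k) :
    (L.map (Step.whisker 1 z)).map (Y.step.total k) = L.map (Step.whisker 1 z') := by
  rw [List.map_map]
  refine List.map_congr_left fun s hs => total_eq ?_
  have h1 : ¬ ActsLeft Y.step Y.words s z k :=
    (actsLeft_congr (chain_mem_eps_phi hL hs).2 (fun _ => rfl) k).not.2 hk
  exact Y.whisker_right_isHom.act_some (x := (s, z)) (y := (s, z'))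
    (by rw [tensor_act_right h1, h]; rfl)

theorem map_total_whisker_left (h : Y.words.act k z = some z') (hL : Chain w L)
    (hk : ActsLeft Y.words Y.words z w k) :
    (L.map (Step.whisker z 1)).map (Y.step.total k) = L.map (Step.whisker z' 1) := by
  rw [List.map_map]
  refine List.map_congr_left fun s hs => total_eq ?_
  have h1 : ActsLeft Y.words Y.step z s k :=
    (actsLeft_congr (fun _ => rfl) (chain_mem_eps_phi hL hs).1 k).2 hk
  exact Y.whisker_left_isHom.act_some (x := (z, s)) (y := (z', s))
    (by rw [tensor_act_left h1, h]; rfl)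

theorem map_total_whisker_left_of_not (h : Y.words.act k w = some w') (hL : Chain w L)
    (hk : ¬ ActsLeft Y.words Y.words z w k) :
    (L.map (Step.whisker z 1)).map (Y.step.total k) =
      (L.map (Y.step.total k)).map (Step.whisker z 1) := by
  rw [List.map_map, List.map_map]
  refine List.map_congr_left fun s hs => total_eq ?_
  have h1 : ¬ ActsLeft Y.words Y.step z s k :=
    (actsLeft_congr (fun _ => rfl) (chain_mem_eps_phi hL hs).1 k).not.2 hk
  exact Y.whisker_left_isHom.act_some (x := (z, s)) (y := (z, Y.step.total k s))
    (by rw [tensor_act_right h1, chain_mem_act h hL hs]; rfl)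

end Whisker

theorem hcomp_steps (a b : Y.Seq) : (Seq.hcomp a b).steps =
    a.steps.map (Step.whisker 1 b.src) ++ b.steps.map (Step.whisker a.tgt 1) := rfl

/-- The first half of `⋆₀` has the source of `b` on the right and the second half has the target of
`a` on the left. Since `φ` agrees on the source and target of `a`, the operator chooses the left
factor in both halves. -/
theorem seqAct_hcomp_left {k : KashiwaraOp I} {a a' b : Y.Seq} (h : Y.seqAct k a = some a')
    (hk : ActsLeft Y.words Y.words a.src b.src k) :
    Y.seqAct k (Seq.hcomp a b) = some (Seq.hcomp a' b) := by
  have ht := seqAct_tgt h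
  have hk' : ActsLeft Y.words Y.words a.tgt b.src k :=
    (actsLeft_congr (endpt_wt_eps a.chain).2.2 (fun _ => rfl) k).2 hk
  rw [seqAct_eq_some] at h ⊢
  refine ⟨by simp [Seq.src_hcomp, word_act_mul_left _ hk, h.1], ?_⟩
  rw [hcomp_steps, hcomp_steps, List.map_append, map_total_whisker_right h.1 a.chain hk,
    map_total_whisker_left ht b.chain hk', h.2]

theorem seqAct_hcomp_right {k : KashiwaraOp I} {a b b' : Y.Seq} (h : Y.seqAct k b = some b')
    (hk : ¬ ActsLeft Y.words Y.words a.src b.src k) :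
    Y.seqAct k (Seq.hcomp a b) = some (Seq.hcomp a b') := by
  have hk' : ¬ ActsLeft Y.words Y.words a.tgt b.src k :=
    (actsLeft_congr (endpt_wt_eps a.chain).2.2 (fun _ => rfl) k).not.2 hk
  rw [seqAct_eq_some] at h ⊢
  refine ⟨by simp [Seq.src_hcomp, word_act_mul_right _ hk, h.1], ?_⟩
  rw [hcomp_steps, hcomp_steps, List.map_append, map_total_whisker_right_of_not h.1 a.chain hk,
    map_total_whisker_left_of_not h.1 b.chain hk', h.2]

theorem seqAct_vcomp {k : KashiwaraOp I} {a a' b : Y.Seq} (h : Y.seqAct k a = some a')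
    (hab : a.tgt = b.src) : ∃ b', ∃ hab' : a'.tgt = b'.src, Y.seqAct k b = some b' ∧
      Y.seqAct k (Seq.vcomp a b hab) = some (Seq.vcomp a' b' hab') := by
  have ht := seqAct_tgt h
  rw [hab] at ht
  rw [seqAct_eq_some] at h
  refine ⟨⟨a'.tgt, b.steps.map (Y.step.total k), chain_act ht b.chain⟩, rfl, ?_, ?_⟩
  · rw [seqAct_eq_some]
    exact ⟨ht, rfl⟩
  · rw [seqAct_eq_some]
    exact ⟨h.1, by simp [Seq.vcomp, h.2]⟩

/-! ### The crystals of sequences and of 2-cells. -/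

/-- The crystal structure on sequences of steps. -/
def seq (Y : CrystalTwoPolygraph.{u, v} D) : Crystal D Y.Seq :=
  Y.words.lift Seq.src Y.seqAct seqAct_src
    fun _ _ _ => ⟨fun h => seqAct_inv h, fun h => seqAct_inv h⟩

theorem seq_act (k : KashiwaraOp I) (a : Y.Seq) : Y.seq.act k a = Y.seqAct k a :=
  congrFun (lift_act ..) a

/-- The relations are stable under the simultaneous action of the Kashiwara operators. -/
def IsStable (Y : CrystalTwoPolygraph.{u, v} D) (R : Relations Y.toTwoPolygraph) : Prop :=
  ∀ L M, R.rel L M → ∀ k w w', Chain w L → Chain w M → Y.words.act k w = some w' →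
    R.rel (L.map (Y.step.total k)) (M.map (Y.step.total k))

variable {R : Relations Y.toTwoPolygraph}

/-- Stability is applied at the word reached after the common prefix, where the operator is still
nonzero. -/
theorem IsStable.rewrites (hR : Y.IsStable R) {k : KashiwaraOp I} {a b a' b' : Y.Seq}
    (h : Seq.Rewrites R a b) (ha : Y.seqAct k a = some a') (hb : Y.seqAct k b = some b') :
    Seq.Rewrites R a' b' := by
  obtain ⟨hs, p, L, M, q, hr, h1, h2⟩ := h
  rw [seqAct_eq_some] at ha hb
  refine ⟨?_, p.map (Y.step.total k), _, _, q.map (Y.step.total k),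
    hR L M hr k (endpt a.src p) (endpt a'.src (p.map (Y.step.total k))) ?_ ?_ ?_,
    by simp [ha.2, h1], by simp [hb.2, h2]⟩
  · have := ha.1
    rw [hs, hb.1] at this
    exact (Option.some.inj this).symm
  · have := a.chain
    rw [h1, chain_append, chain_append] at this
    exact this.1.2
  · have := b.chain
    rw [h2, chain_append, chain_append, ← hs] at this
    exact this.1.2
  · have := a.chain
    rw [h1, chain_append, chain_append] at this
    exact endpt_act ha.1 this.1.1

/-- The action of a Kashiwara operator on 2-cells. -/
def cellAct (hR : Y.IsStable R) (k : KashiwaraOp I) : Cell R → Option (Cell R) :=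
  Quot.lift (fun a => (Y.seqAct k a).map (Cell.mk R)) fun a b h => by
    -- Related sequences have equal sources, so the operator kills both or neither.
    have e : (Y.seqAct k a).map Seq.src = (Y.seqAct k b).map Seq.src := by
      rw [seqAct_src, seqAct_src, h.1]
    cases ha : Y.seqAct k a with
    | none => cases hb : Y.seqAct k b with
      | none => rfl
      | some b' => simp [ha, hb] at e
    | some a' => cases hb : Y.seqAct k b with
      | none => simp [ha, hb] at e
      | some b' => exact congrArg some (Cell.sound (hR.rewrites h ha hb))

theorem cellAct_mk (hR : Y.IsStable R) (k : KashiwaraOp I) (a : Y.Seq) :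
    cellAct hR k (Cell.mk R a) = (Y.seqAct k a).map (Cell.mk R) := rfl

theorem cellAct_inv (hR : Y.IsStable R) {k : KashiwaraOp I} {a b : Cell R}
    (h : cellAct hR k a = some b) : cellAct hR k.inv b = some a := by
  obtain ⟨a⟩ := a
  obtain ⟨b', hb, rfl⟩ := Option.map_eq_some_iff.1 h
  exact Option.map_eq_some_iff.2 ⟨a, seqAct_inv hb, rfl⟩

/-- The crystal structure on 2-cells. -/
def cell (hR : Y.IsStable R) : Crystal D (Cell R) :=
  Y.words.lift Cell.src (cellAct hR)
    (fun k => by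
      rintro ⟨a⟩
      refine Eq.trans ?_ (seqAct_src k a)
      exact Option.map_map ..)
    fun _ _ _ => ⟨fun h => cellAct_inv hR h, fun h => cellAct_inv hR h⟩

theorem cell_act (hR : Y.IsStable R) (k : KashiwaraOp I) (a : Cell R) :
    (Y.cell hR).act k a = cellAct hR k a :=
  congrFun (lift_act ..) a

theorem cell_src_isHom (hR : Y.IsStable R) : IsHom (Y.cell hR) Y.words Cell.src := lift_isHom ..

theorem cell_mk_isHom (hR : Y.IsStable R) : IsHom Y.seq (Y.cell hR) (Cell.mk R) :=
  .of_wt_eps_act (fun _ => rfl) (fun _ _ => rfl) fun k a b h => by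
    rw [seq_act] at h
    rw [cell_act, cellAct_mk, h]
    rfl

theorem cell_tgt_isHom (hR : Y.IsStable R) : IsHom (Y.cell hR) Y.words Cell.tgt := by
  refine .of_wt_eps_act ?_ ?_ ?_
  · rintro ⟨a⟩
    exact (endpt_wt_eps a.chain).1
  · rintro i ⟨a⟩
    exact (endpt_wt_eps a.chain).2.1 i
  · rintro k ⟨a⟩ b h
    obtain ⟨b', hb, rfl⟩ := Option.map_eq_some_iff.1 ((cell_act hR k _).symm.trans h)
    exact seqAct_tgt hb

theorem seq_id_isHom : IsHom Y.words Y.seq Seq.id :=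
  .of_wt_eps_act (fun _ => rfl) (fun _ _ => rfl) fun k w w' h => by
    rw [seq_act, seqAct_eq_some]
    exact ⟨h, rfl⟩

theorem step_gen_isHom : IsHom Y.crystal₂ Y.step (fun α => ⟨1, α, 1⟩) := by
  refine .of_wt_eps_e (fun α => ?_) (fun i α => ?_) (fun i α β h => ?_)
  · rw [← Y.step_src_isHom.wt, ← Y.src_isHom.wt]
    simp [Step.src]
  · rw [← Y.step_src_isHom.ε, ← Y.src_isHom.ε]
    simp [Step.src]
  · have hl : ActsLeft Y.crystal₂ Y.words α 1 (.e i) := Nat.zero_le _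
    have h1 : (Y.crystal₂.tensor Y.words).act (.e i) (α, 1) = some (β, 1) := by
      rw [tensor_act_left hl, act, h, Option.map_some]
    -- The empty word has `φ = 0`, so acting on it would require `ε = 0` on the right factor,
    -- whereas `e` does not kill that factor.
    have hr : ¬ ActsLeft Y.words (Y.crystal₂.tensor Y.words) 1 (α, 1) (.e i) := by
      refine Nat.not_le.2 (Nat.pos_iff_ne_zero.2 fun h0 => ?_)
      cases h1.symm.trans ((e_none _ i _).2 h0)
    refine Y.step_mk_isHom.act_some (k := .e i) (x := (1, α, 1)) (y := (1, β, 1)) ?_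
    rw [tensor_act_right hr, h1, Option.map_some]

theorem gen_isHom (hR : Y.IsStable R) : IsHom Y.crystal₂ (Y.cell hR) R.gen := by
  refine .of_wt_eps_act Y.src_isHom.wt Y.src_isHom.ε fun k α β h => ?_
  refine (cell_act hR k _).trans (Option.map_eq_some_iff.2 ⟨_, seqAct_eq_some.2 ⟨?_, ?_⟩, rfl⟩)
  · exact Y.src_isHom.act_some h
  · simp [total_eq (Y.step_gen_isHom.act_some h)]

end CrystalTwoPolygraph
-- Connected components, local injectivity and `𝔤-Cryst`.
namespace Crystal

variable {I P Pv : Type*} [AddCommGroup P] [AddCommGroup Pv] {D : CartanDatum I P Pv}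
variable {Γ Γ' Γ'' : Type*} {c : Crystal D Γ} {c' : Crystal D Γ'} {c'' : Crystal D Γ''}

theorem componentSet_symm {x y : Γ} (h : y ∈ c.componentSet x) : x ∈ c.componentSet y := by
  induction h with
  | refl => exact .refl
  | tail _ h ih =>
    obtain ⟨k, h⟩ := h
    exact .head ⟨_, c.act_inv.1 h⟩ ih

theorem componentSet_trans {x y z : Γ} (h : y ∈ c.componentSet x) (h' : z ∈ c.componentSet y) :
    z ∈ c.componentSet x :=
  Relation.ReflTransGen.trans h h'

theorem component_e {x : Γ} {i : I} {y z : c.componentSet x} :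
    (c.component x).e i y = some z ↔ c.e i y = some z.1 := by
  refine Option.pmap_eq_some_iff.trans ⟨?_, fun h => ⟨_, z.2, h, rfl⟩⟩
  rintro ⟨a, ha, h, rfl⟩
  exact h

theorem component_val_isHom (c : Crystal D Γ) (x : Γ) : IsHom (c.component x) c Subtype.val :=
  .of_wt_eps_e (fun _ => rfl) (fun _ _ => rfl) fun _ _ _ h => component_e.1 h

theorem IsHom.mem_componentSet {F : Γ → Γ'} (h : IsHom c c' F) {x y : Γ}
    (hy : y ∈ c.componentSet x) : F y ∈ c'.componentSet (F x) := by
  induction hy with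
  | refl => exact .refl
  | tail _ h1 ih =>
    obtain ⟨k, h1⟩ := h1
    exact .tail ih ⟨k, h.act_some h1⟩

/-- Strict morphisms commute with `0`, so paths of Kashiwara operators lift. -/
theorem IsHom.exists_mem_componentSet {F : Γ → Γ'} (h : IsHom c c' F) {x : Γ} {z : Γ'}
    (hz : z ∈ c'.componentSet (F x)) : ∃ y ∈ c.componentSet x, F y = z := by
  induction hz with
  | refl => exact ⟨x, .refl, rfl⟩
  | tail _ h1 ih =>
    obtain ⟨k, h1⟩ := h1
    obtain ⟨y, hy, rfl⟩ := ih
    obtain ⟨y', hy', rfl⟩ := h.exists_act h1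
    exact ⟨y', .tail hy ⟨k, hy'⟩, rfl⟩

theorem Iso.symm (h : Iso c c') : Iso c' c := by
  obtain ⟨θ, h⟩ := h
  exact ⟨θ.symm, h.symm⟩

theorem Iso.trans (h : Iso c c') (h' : Iso c' c'') : Iso c c'' := by
  obtain ⟨θ, h⟩ := h
  obtain ⟨ψ, h'⟩ := h'
  exact ⟨θ.trans ψ, h'.comp h⟩

/-- The map `F` is injective on every connected component. -/
def LocallyInjective (c : Crystal D Γ) (F : Γ → Γ') : Prop :=
  ∀ x, ∀ y ∈ c.componentSet x, F x = F y → x = y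

theorem IsHom.component_iso {F : Γ → Γ'} (h : IsHom c c' F) (hF : LocallyInjective c F) (x : Γ) :
    Iso (c.component x) (c'.component (F x)) := by
  let G : c.componentSet x → c'.componentSet (F x) := fun y => ⟨F y, h.mem_componentSet y.2⟩
  have hG : Function.Bijective G := by
    constructor
    · intro y z hyz
      exact Subtype.ext (hF _ _ (componentSet_trans (componentSet_symm y.2) z.2)
        (congrArg Subtype.val hyz))
    · rintro ⟨z, hz⟩
      obtain ⟨y, hy, rfl⟩ := h.exists_mem_componentSet hz
      exact ⟨⟨y, hy⟩, rfl⟩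
  refine ⟨Equiv.ofBijective G hG, .of_wt_eps_e (fun y => h.wt y) (fun i y => h.ε i y) ?_⟩
  intro i y z hyz
  rw [component_e] at hyz ⊢
  exact h.act_some (k := .e i) hyz

theorem IsHom.component_iso_of_injective {F : Γ → Γ'} (h : IsHom c c' F)
    (hF : Function.Injective F) (x : Γ) : Iso (c.component x) (c'.component (F x)) :=
  h.component_iso (fun _ _ _ e => hF e) x

/-- Induction on a path of `f` operators from the highest weight element `u` to `z`. Anything with
the image of `u` is killed by all `e`, hence is `u`; otherwise the last `f` is undone by `e` on both
elements. -/
theorem IsHighestWeight.injective {l : P} (hc : c.IsHighestWeight l) {F : Γ → Γ'}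
    (h : IsHom c c' F) : Function.Injective F := by
  obtain ⟨u, ⟨he, -, hu⟩, -⟩ := hc
  suffices H : ∀ z, ∀ y, F y = F z → y = z from fun y z e => H z y e
  intro z
  have hz := hu z
  induction hz with
  | refl =>
    intro y e
    obtain rfl | ⟨x, -, i, hx⟩ := Relation.ReflTransGen.cases_tail (hu y)
    · rfl
    · have h2 := h.act_some (k := .e i) ((c.e_iff_f i _ _).2 hx)
      rw [e, h.act, act, he] at h2
      cases h2
  | tail _ h1 ih =>
    obtain ⟨i, h1⟩ := h1
    intro y e
    have h2 := h.act (.e i) y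
    rw [e, h.act_some (k := .e i) ((c.e_iff_f i _ _).2 h1)] at h2
    obtain ⟨y', hy, e'⟩ := Option.map_eq_some_iff.1 h2.symm
    rw [ih y' e', act, c.e_iff_f, h1] at hy
    exact (Option.some.inj hy).symm

theorem IsHom.locallyInjective {F : Γ → Γ'} (h : IsHom c c' F) (hc : c.InGCryst) :
    LocallyInjective c F := by
  obtain ⟨B, b, hb, H⟩ := hc
  intro x y hy e
  obtain ⟨l, θ, hθ⟩ := H x
  have h1 := (hb.highestWeight l).injective ((h.comp (c.component_val_isHom x)).comp hθ.symm)
  have h2 := @h1 (θ ⟨x, .refl⟩) (θ ⟨y, hy⟩) (by simpa using e)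
  exact congrArg Subtype.val (θ.injective h2)

theorem tensor_mem_componentSet {x y : Γ × Γ'} (h : y ∈ (c.tensor c').componentSet x) :
    y.1 ∈ c.componentSet x.1 ∧ y.2 ∈ c'.componentSet x.2 := by
  induction h with
  | refl => exact ⟨.refl, .refl⟩
  | @tail y z _ h1 ih =>
    obtain ⟨k, h1⟩ := h1
    by_cases hk : ActsLeft c c' y.1 y.2 k
    · obtain ⟨a, ha, rfl⟩ := Option.map_eq_some_iff.1 ((tensor_act_left hk).symm.trans h1)
      exact ⟨.tail ih.1 ⟨k, ha⟩, ih.2⟩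
    · obtain ⟨a, ha, rfl⟩ := Option.map_eq_some_iff.1 ((tensor_act_right hk).symm.trans h1)
      exact ⟨ih.1, .tail ih.2 ⟨k, ha⟩⟩

theorem length_eq_of_mem_componentSet (c : Crystal D Γ) {u w : FreeMonoid Γ}
    (h : w ∈ c.word.componentSet u) : w.length = u.length := by
  induction h with
  | refl => rfl
  | tail _ h1 ih =>
    obtain ⟨k, h1⟩ := h1
    exact (c.length_act h1).trans ih

section Family

variable {B : D.Dominant → Type} {b : ∀ l, Crystal D (B l)}

/-- The component of `(x, y)` already lies in the tensor product of the components of `x` and `y`,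
which is isomorphic to some `B(l) ⊗ B(m)`. -/
theorem tensor_component_iso (hb : IsClosedFamily b) {x : Γ} {y : Γ'}
    (hx : ∃ l, Iso (c.component x) (b l)) (hy : ∃ l, Iso (c'.component y) (b l)) :
    ∃ l, Iso ((c.tensor c').component (x, y)) (b l) := by
  obtain ⟨l, θ, hθ⟩ := hx
  obtain ⟨m, ψ, hψ⟩ := hy
  have h1 := ((c.component_val_isHom x).tensor
    (c'.component_val_isHom y)).component_iso_of_injective
      (Subtype.val_injective.prodMap Subtype.val_injective) (⟨x, .refl⟩, ⟨y, .refl⟩)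
  have h2 := (hθ.tensor hψ).component_iso_of_injective
      (θ.injective.prodMap ψ.injective) (⟨x, .refl⟩, ⟨y, .refl⟩)
  obtain ⟨n, hn⟩ := hb.closed l m (θ ⟨x, .refl⟩, ψ ⟨y, .refl⟩)
  exact ⟨n, (h1.symm.trans h2).trans hn⟩

/-- At the highest weight element `ε = 0`, and weight zero forces `φ = 0`, so no `f` leaves it. -/
theorem IsHighestWeight.subsingleton (hc : c.IsHighestWeight 0) :
    ∃ u, (∀ i, c.ε i u = 0) ∧ c.wt u = 0 ∧ ∀ x, x = u := by
  obtain ⟨u, ⟨h1, h2, h3⟩, -⟩ := hc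
  have hε : ∀ i, c.ε i u = 0 := fun i => (c.e_none i u).1 (h1 i)
  refine ⟨u, hε, h2, fun x => ?_⟩
  obtain rfl | ⟨y, hy, -⟩ := Relation.ReflTransGen.cases_head (h3 x)
  · rfl
  · obtain ⟨i, hi⟩ := hy
    have h4 := c.weight i u
    have h5 := c.phi_f hi
    simp [h2, hε] at h4
    omega

theorem word_component_iso (hb : IsClosedFamily b) (hc : ∀ x, ∃ l, Iso (c.component x) (b l))
    (w : FreeMonoid Γ) : ∃ l, Iso (c.word.component w) (b l) := by
  induction w using FreeMonoid.inductionOn' with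
  | one =>
    -- The component of the empty word is the one-point crystal `B(0)`.
    obtain ⟨u, h1, h2, h3⟩ := (hb.highestWeight ⟨0, by simp⟩).subsingleton
    have h4 : ∀ y : c.word.componentSet 1, y.1 = 1 := fun y =>
      FreeMonoid.length_eq_zero.1 (c.length_eq_of_mem_componentSet y.2)
    refine ⟨_, Equiv.ofBijective (fun _ => u)
      ⟨fun y z _ => Subtype.ext ((h4 y).trans (h4 z).symm), fun x => ⟨⟨1, .refl⟩, (h3 x).symm⟩⟩,
      .of_wt_eps_e (fun y => ?_) (fun i y => ?_) (fun i y z h => ?_)⟩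
    · refine h2.trans ?_
      change 0 = c.word.wt y.1
      rw [h4]
      rfl
    · refine (h1 i).trans ?_
      change 0 = c.word.ε i y.1
      rw [h4]
      rfl
    · rw [component_e, h4] at h
      cases (c.word_act_one (.e i)).symm.trans h
  | of_mul x w ih =>
    obtain ⟨l, hl⟩ := tensor_component_iso hb (hc x) ih
    refine ⟨l, Iso.trans (Iso.symm ?_) hl⟩
    exact c.word_cons_isHom.component_iso_of_injective
      (fun p q h => Prod.ext (List.cons.inj h).1 (List.cons.inj h).2) (x, w)

end Family

theorem word_isPresentedBy (c : Crystal D Γ) : IsPresentedBy c.word c := by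
  refine ⟨Con.ker (MonoidHom.id _), ?_,
    Con.quotientKerEquivOfRightInverse (MonoidHom.id _) _root_.id fun _ => rfl, ?_⟩
  · rintro w w' h
    obtain rfl : w = w' := h
    exact ⟨Equiv.refl _, IsHom.id _, rfl⟩
  · exact IsHom.id _

theorem InGCryst.word (hc : c.InGCryst) : c.word.InGCryst := by
  obtain ⟨B, b, hb, H⟩ := hc
  exact ⟨B, b, hb, word_component_iso hb H⟩

theorem InGCryst.of_locallyInjective {F : Γ → Γ'} (h : IsHom c c' F)
    (hF : LocallyInjective c F) (hc' : c'.InGCryst) : c.InGCryst := by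
  obtain ⟨B, b, hb, H⟩ := hc'
  refine ⟨B, b, hb, fun x => ?_⟩
  obtain ⟨l, hl⟩ := H (F x)
  exact ⟨l, (h.component_iso hF x).trans hl⟩

/-! ### Disjoint unions, for the generators with formal inverses. -/

/-- The disjoint union of two crystals. -/
def sum (c : Crystal D Γ) (c' : Crystal D Γ') : Crystal D (Γ ⊕ Γ') where
  wt := Sum.elim c.wt c'.wt
  ε i := Sum.elim (c.ε i) (c'.ε i)
  φ i := Sum.elim (c.φ i) (c'.φ i)
  e i := Sum.elim (fun x => (c.e i x).map Sum.inl) (fun x => (c'.e i x).map Sum.inr)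
  f i := Sum.elim (fun x => (c.f i x).map Sum.inl) (fun x => (c'.f i x).map Sum.inr)
  weight i := by
    rintro (x | x)
    · exact c.weight i x
    · exact c'.weight i x
  eps_max i := by
    refine partialIter_isGreatest _ _ ?_ ?_
    · rintro (x | x) <;> simp [e_none]
    · rintro (x | x) y h <;> obtain ⟨a, ha, rfl⟩ := Option.map_eq_some_iff.1 h
      · exact (c.eps_e ha).1
      · exact (c'.eps_e ha).1
  phi_max i := by
    refine partialIter_isGreatest _ _ ?_ ?_
    · rintro (x | x) <;> simp [f_none]
    · rintro (x | x) y h <;> obtain ⟨a, ha, rfl⟩ := Option.map_eq_some_iff.1 h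
      · exact (c.phi_f ha).1
      · exact (c'.phi_f ha).1
  wt_e i := by
    rintro (x | x) y h <;> obtain ⟨a, ha, rfl⟩ := Option.map_eq_some_iff.1 h
    · exact c.wt_e i _ _ ha
    · exact c'.wt_e i _ _ ha
  wt_f i := by
    rintro (x | x) y h <;> obtain ⟨a, ha, rfl⟩ := Option.map_eq_some_iff.1 h
    · exact c.wt_f i _ _ ha
    · exact c'.wt_f i _ _ ha
  e_iff_f i := by
    rintro (x | x) (y | y) <;> simp [e_iff_f]

theorem sum_inl_isHom : IsHom c (c.sum c') Sum.inl :=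
  ⟨fun _ => rfl, fun _ _ => rfl, fun _ _ => rfl, fun _ _ => rfl, fun _ _ => rfl⟩

theorem sum_inr_isHom : IsHom c' (c.sum c') Sum.inr :=
  ⟨fun _ => rfl, fun _ _ => rfl, fun _ _ => rfl, fun _ _ => rfl, fun _ _ => rfl⟩

theorem IsHom.sum_elim {F : Γ → Γ''} {G : Γ' → Γ''} (hF : IsHom c c'' F) (hG : IsHom c' c'' G) :
    IsHom (c.sum c') c'' (Sum.elim F G) := by
  refine .of_wt_eps_e ?_ ?_ ?_
  · rintro (x | x)
    · exact hF.wt x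
    · exact hG.wt x
  · rintro i (x | x)
    · exact hF.ε i x
    · exact hG.ε i x
  · rintro i (x | x) y h <;> obtain ⟨a, ha, rfl⟩ := Option.map_eq_some_iff.1 h
    · exact hF.act_some (k := .e i) ha
    · exact hG.act_some (k := .e i) ha

theorem InGCryst.sum_self (hc : c.InGCryst) : (c.sum c).InGCryst := by
  obtain ⟨B, b, hb, H⟩ := hc
  refine ⟨B, b, hb, ?_⟩
  rintro (x | x) <;> obtain ⟨l, hl⟩ := H x
  · exact ⟨l, (sum_inl_isHom.component_iso_of_injective Sum.inl_injective x).symm.trans hl⟩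
  · exact ⟨l, (sum_inr_isHom.component_iso_of_injective Sum.inr_injective x).symm.trans hl⟩

end Crystal
-- Local injectivity of the source map.
namespace CrystalTwoPolygraph

open TwoPolygraph Crystal

variable {I P Pv : Type*} [AddCommGroup P] [AddCommGroup Pv] {D : CartanDatum I P Pv}
variable {Y : CrystalTwoPolygraph.{u, v} D} {R : Relations Y.toTwoPolygraph}

/-- Within a component the lengths of the left word and of the source of the generator are constant,
so equal sources are cut at the same places. -/
theorem step_src_locallyInjective (h : LocallyInjective Y.crystal₂ Y.src) :
    LocallyInjective Y.step Step.src := by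
  rintro ⟨x, α, y⟩ ⟨x', α', y'⟩ hst e
  obtain ⟨h1, h2⟩ := tensor_mem_componentSet (Y.step_equivProd_isHom.mem_componentSet hst)
  obtain ⟨h3, -⟩ := tensor_mem_componentSet h2
  change x' ∈ Y.words.componentSet x at h1
  change α' ∈ Y.crystal₂.componentSet α at h3
  have e' : x * Y.src α * y = x' * Y.src α' * y' := e
  rw [mul_assoc, mul_assoc] at e'
  obtain ⟨rfl, e2⟩ := FreeMonoid.mul_inj_of_length
    (Y.crystal₁.length_eq_of_mem_componentSet h1).symm e'
  obtain ⟨e1, rfl⟩ := FreeMonoid.mul_inj_of_length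
    (Y.crystal₁.length_eq_of_mem_componentSet (Y.src_isHom.mem_componentSet h3)).symm e2
  rw [h α α' h3 e1]

theorem seq_nil_mem {w : FreeMonoid Y.gen₁} {b : Y.Seq}
    (h : b ∈ Y.seq.componentSet (Seq.id w)) : b.steps = [] := by
  induction h with
  | refl => rfl
  | tail _ h1 ih =>
    obtain ⟨k, h1⟩ := h1
    rw [seq_act, seqAct_eq_some] at h1
    simp [h1.2, ih]

/-- The same operators move the head and the tail, so each of them stays in its own component. -/
theorem seq_cons_mem {s : Y.Step} {M : List Y.Step} (hM : Chain s.tgt M) {b : Y.Seq}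
    (h : b ∈ Y.seq.componentSet ⟨s.src, s :: M, rfl, hM⟩) :
    ∃ t N, ∃ hN : Chain t.tgt N, b.steps = t :: N ∧ t ∈ Y.step.componentSet s ∧
      (⟨t.tgt, N, hN⟩ : Y.Seq) ∈ Y.seq.componentSet ⟨s.tgt, M, hM⟩ := by
  induction h with
  | refl => exact ⟨s, M, hM, rfl, .refl, .refl⟩
  | @tail b c _ h1 ih =>
    obtain ⟨k, h1⟩ := h1
    obtain ⟨t, N, hN, e, ht, hb⟩ := ih
    rw [seq_act, seqAct_eq_some] at h1
    have hc := b.chain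
    rw [e] at hc
    have h2 := h1.1
    rw [← hc.1] at h2
    refine ⟨Y.step.total k t, N.map (Y.step.total k), chain_act (step_act_tgt h2) hN,
      by simp [h1.2, e], .tail ht ⟨k, (step_act h2).1⟩, .tail hb ⟨k, ?_⟩⟩
    rw [seq_act, seqAct_eq_some]
    exact ⟨step_act_tgt h2, rfl⟩

/-- The source determines the first step, hence its target, which is the source of the remaining
sequence. -/
theorem seq_src_locallyInjective (h : LocallyInjective Y.crystal₂ Y.src) :
    LocallyInjective Y.seq Seq.src := by
  rintro ⟨w, L, hL⟩
  induction L generalizing w with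
  | nil =>
    intro b hb e
    exact Seq.ext e (seq_nil_mem hb).symm
  | cons s M ih =>
    obtain ⟨rfl, hM⟩ := hL
    intro b hb e
    obtain ⟨t, N, hN, e1, ht, hb'⟩ := seq_cons_mem hM hb
    have hc := b.chain
    rw [e1] at hc
    obtain rfl := step_src_locallyInjective h s t ht (e.trans hc.1.symm)
    have h2 := ih _ hM _ hb' rfl
    refine Seq.ext e ?_
    rw [e1]
    exact congrArg (s :: ·) (congrArg Seq.steps h2)

theorem cell_src_locallyInjective (hR : Y.IsStable R) (h : LocallyInjective Y.crystal₂ Y.src) :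
    LocallyInjective (Y.cell hR) Cell.src := by
  rintro ⟨a⟩ y hy e
  obtain ⟨b, hb, rfl⟩ := (cell_mk_isHom hR).exists_mem_componentSet (x := a) hy
  exact congrArg (Cell.mk R) (seq_src_locallyInjective h a b hb e)

/-! ### The axiom (CM4) for 2-cells, and the resulting crystal 2-monoid. -/

/-- (CM4) is phrased by equations between words, and this recovers the tensor rule. If the operator
acted on `w`, cancelling by length would give `u' = u`, but no operator fixes an element. -/
theorem actsLeft_of_act_mul {k : KashiwaraOp I} {u w u' : FreeMonoid Y.gen₁}
    (h : Y.words.act k (u * w) = (Y.words.act k u).map (fun z => z * w))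
    (hu : Y.words.act k u = some u') : ActsLeft Y.words Y.words u w k := by
  by_contra hk
  rw [word_act_mul_right _ hk, hu, Option.map_some, Option.map_eq_some_iff] at h
  obtain ⟨z, -, e⟩ := h
  obtain ⟨rfl, -⟩ := FreeMonoid.mul_inj_of_length (Y.crystal₁.length_act hu).symm e
  exact Y.words.act_ne_self _ _ hu

theorem not_actsLeft_of_act_mul {k : KashiwaraOp I} {u w w' : FreeMonoid Y.gen₁}
    (h : Y.words.act k (u * w) = (Y.words.act k w).map (fun z => u * z))
    (hw : Y.words.act k w = some w') : ¬ ActsLeft Y.words Y.words u w k := by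
  intro hk
  rw [word_act_mul_left _ hk, hw, Option.map_some, Option.map_eq_some_iff] at h
  obtain ⟨z, hz, e⟩ := h
  obtain ⟨-, rfl⟩ := FreeMonoid.mul_inj_of_length (Y.crystal₁.length_act hz) e
  exact Y.words.act_ne_self _ _ hw

theorem cellAct_eq_none (hR : Y.IsStable R) {k : KashiwaraOp I} {a : Cell R} :
    cellAct hR k a = none ↔ Y.words.act k a.src = none := by
  rw [(cell_src_isHom hR).act, cell_act, Option.map_eq_none_iff]

theorem exists_seqAct (hR : Y.IsStable R) {k : KashiwaraOp I} {a : Y.Seq}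
    (h : cellAct hR k (Cell.mk R a) ≠ none) :
    ∃ b, Y.seqAct k a = some b ∧ cellAct hR k (Cell.mk R a) = some (Cell.mk R b) := by
  rw [cellAct_mk] at h ⊢
  cases hb : Y.seqAct k a with
  | none => simp [hb] at h
  | some b => exact ⟨b, rfl, rfl⟩

theorem cellAct_hcomp_left (hR : Y.IsStable R) (k : KashiwaraOp I) (a b : Cell R)
    (h : Y.words.act k (a.src * b.src) = (Y.words.act k a.src).map fun w => w * b.src) :
    cellAct hR k (a.hcomp b) = (cellAct hR k a).map fun a' => a'.hcomp b := by
  by_cases ha : cellAct hR k a = none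
  · rw [ha, Option.map_none, cellAct_eq_none]
    rw [cellAct_eq_none] at ha
    have e : (a.hcomp b).src = a.src * b.src := R.twoMonoid.src_hcomp a b
    rw [e, h, ha, Option.map_none]
  · obtain ⟨a, rfl⟩ := Quot.exists_rep a
    obtain ⟨b, rfl⟩ := Quot.exists_rep b
    obtain ⟨a', h1, h2⟩ := exists_seqAct hR ha
    have hk := actsLeft_of_act_mul h (seqAct_eq_some.1 h1).1
    refine Eq.trans ?_ (congrArg (Option.map _) h2).symm
    exact Option.map_eq_some_iff.2 ⟨_, seqAct_hcomp_left h1 hk, rfl⟩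

theorem cellAct_hcomp_right (hR : Y.IsStable R) (k : KashiwaraOp I) (a b : Cell R)
    (h : Y.words.act k (a.src * b.src) = (Y.words.act k b.src).map fun w => a.src * w) :
    cellAct hR k (a.hcomp b) = (cellAct hR k b).map fun b' => a.hcomp b' := by
  by_cases hb : cellAct hR k b = none
  · rw [hb, Option.map_none, cellAct_eq_none]
    rw [cellAct_eq_none] at hb
    have e : (a.hcomp b).src = a.src * b.src := R.twoMonoid.src_hcomp a b
    rw [e, h, hb, Option.map_none]
  · obtain ⟨a, rfl⟩ := Quot.exists_rep a
    obtain ⟨b, rfl⟩ := Quot.exists_rep b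
    obtain ⟨b', h1, h2⟩ := exists_seqAct hR hb
    have hk := not_actsLeft_of_act_mul h (seqAct_eq_some.1 h1).1
    refine Eq.trans ?_ (congrArg (Option.map _) h2).symm
    exact Option.map_eq_some_iff.2 ⟨_, seqAct_hcomp_right h1 hk, rfl⟩

theorem cellAct_vcomp (hR : Y.IsStable R) (k : KashiwaraOp I) (a b : Cell R) (h : a.tgt = b.src)
    (ha : Y.words.act k a.src ≠ none) : ∃ (a' b' : Cell R) (h' : a'.tgt = b'.src),
      cellAct hR k a = some a' ∧ cellAct hR k b = some b' ∧
        cellAct hR k (a.vcomp b h) = some (a'.vcomp b' h') := by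
  rw [← (cellAct_eq_none hR).ne] at ha
  obtain ⟨a, rfl⟩ := Quot.exists_rep a
  obtain ⟨b, rfl⟩ := Quot.exists_rep b
  obtain ⟨a', h1, h2⟩ := exists_seqAct hR ha
  obtain ⟨b', hab, h3, h4⟩ := seqAct_vcomp h1 h
  refine ⟨Cell.mk R a', Cell.mk R b', hab, h2, congrArg (Option.map (Cell.mk R)) h3, ?_⟩
  refine (congrArg (cellAct hR k) (Cell.vcomp_mk a b h)).trans ?_
  exact (congrArg (Option.map (Cell.mk R)) h4).trans
    (congrArg some (Cell.vcomp_mk a' b' hab).symm)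

/-- The crystal structure on the 2-monoid presented by stable relations. -/
noncomputable def crystalTwoMonoid (hR : Y.IsStable R) : CrystalTwoMonoid D R.twoMonoid where
  one := Y.words
  two := Y.cell hR
  isCrystalMonoid := ⟨_, _, word_isPresentedBy Y.crystal₁⟩
  src_isHom := cell_src_isHom hR
  tgt_isHom := cell_tgt_isHom hR
  act_hcomp_left k a b h := by
    refine (cell_act hR k _).trans ((cellAct_hcomp_left hR k a b h).trans ?_)
    exact congrArg (Option.map _) (cell_act hR k a).symm
  act_hcomp_right k a b h := by
    refine (cell_act hR k _).trans ((cellAct_hcomp_right hR k a b h).trans ?_)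
    exact congrArg (Option.map _) (cell_act hR k b).symm
  act_hcomp_otherwise k a b h1 h2 := by
    -- This case is vacuous: on a product of words an operator always acts through one of the
    -- factors.
    by_cases hk : ActsLeft Y.words Y.words (Cell.src a) (Cell.src b) k
    · exact absurd (word_act_mul_left _ hk) h1
    · exact absurd (word_act_mul_right _ hk) h2
  act_vcomp k a b h ha := by
    obtain ⟨a', b', h', h1, h2, h3⟩ := cellAct_vcomp hR k a b h ha
    exact ⟨a', b', h', (cell_act hR k a).trans h1, (cell_act hR k b).trans h2,
      (cell_act hR k _).trans h3⟩
  act_vcomp_otherwise k a b h ha := by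
    refine (cell_act hR k _).trans ((cellAct_eq_none hR).2 ?_)
    exact (congrArg (Y.words.act k) (R.twoMonoid.src_vcomp a b h)).trans ha

theorem exists_crystalTwoMonoid (hR : Y.IsStable R) : ∃ S : CrystalTwoMonoid D R.twoMonoid,
    S.one = Y.crystal₁.word ∧ IsHom S.one S.two R.twoMonoid.id ∧
      IsHom Y.crystal₂ S.two (fun α => R.gen α) ∧
      (Y.crystal₁.InGCryst → Y.crystal₂.InGCryst → S.InGCryst) := by
  refine ⟨crystalTwoMonoid hR, rfl, (cell_mk_isHom hR).comp seq_id_isHom, gen_isHom hR,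
    fun h1 h2 => ⟨h1.word, ?_, _, _, h1, word_isPresentedBy _⟩⟩
  exact h1.word.of_locallyInjective (cell_src_isHom hR)
    (cell_src_locallyInjective hR (Y.src_isHom.locallyInjective h2))

/-! ### Stability of the exchange and inverse relations. -/

theorem exchange_total {L M : List Y.Step} (h : Exchange Y.toTwoPolygraph L M)
    {k : KashiwaraOp I} {w w' : FreeMonoid Y.gen₁} (hM : Chain w M)
    (hw : Y.words.act k w = some w') :
    Exchange Y.toTwoPolygraph (L.map (Y.step.total k)) (M.map (Y.step.total k)) := by
  obtain ⟨x, z, y, α, β⟩ := h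
  -- This composite sends `(x, α, z, β, y)` to the common source word of the two sides, so the
  -- action on that word lifts to `exchangeCrystal`.
  have hs := Y.step_src_isHom.comp (Y.exchange_snd_isHom Y.src_isHom)
  obtain ⟨⟨x', α', z', β', y'⟩, h1, -⟩ := hs.exists_act (x := (x, α, z, β, y)) (k := k) (y := w')
    (by rw [← hw, ← hM.1])
  have e1 := total_eq ((Y.exchange_fst_isHom Y.src_isHom).act_some h1)
  have e2 := total_eq ((Y.exchange_snd_isHom Y.tgt_isHom).act_some h1)
  have e3 := total_eq ((Y.exchange_snd_isHom Y.src_isHom).act_some h1)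
  have e4 := total_eq ((Y.exchange_fst_isHom Y.tgt_isHom).act_some h1)
  dsimp only at e1 e2 e3 e4
  simp only [List.map_cons, List.map_nil, e1, e2, e3, e4]
  exact .mk x' z' y' α' β'

theorem exchangeRelations_isStable (Y : CrystalTwoPolygraph.{u, v} D) :
    Y.IsStable Y.exchangeRelations :=
  fun _ _ h _ _ _ _ hM hw => exchange_total h hM hw

/-- The crystal structure on the 2-polygraph with formal inverses. -/
def double (X : CrystalTwoPolygraph.{u, v} D) : CrystalTwoPolygraph.{u, v} D where
  toTwoPolygraph := X.toTwoPolygraph.double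
  crystal₁ := X.crystal₁
  crystal₂ := X.crystal₂.sum X.crystal₂
  src_isHom := X.src_isHom.sum_elim X.tgt_isHom
  tgt_isHom := X.tgt_isHom.sum_elim X.src_isHom

theorem step_map_gen_isHom (X : CrystalTwoPolygraph.{u, v} D) {F : X.gen₂ → X.double.gen₂}
    (hF : IsHom X.crystal₂ X.double.crystal₂ F) :
    IsHom X.step X.double.step (fun s => ⟨s.left, F s.gen, s.right⟩) :=
  X.double.step_mk_isHom.comp (((IsHom.id X.words).tensor
    (hF.tensor (IsHom.id X.words))).comp X.step_equivProd_isHom)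

/-- The steps `xαy` and `xα⁻y` are images of one step of `X` under two morphisms, so an operator
sends them to mutually inverse steps again. -/
theorem topRelations_isStable (X : CrystalTwoPolygraph.{u, v} D) :
    X.double.IsStable X.topRelations := by
  have hl := X.step_map_gen_isHom (F := Sum.inl) sum_inl_isHom
  have hr := X.step_map_gen_isHom (F := Sum.inr) sum_inr_isHom
  rintro _ _ (h | ⟨x, y, α⟩ | ⟨x, y, α⟩) k w w' hL hM hw
  · exact .exchange (exchange_total h hM hw)
  · have h0 : X.words.act k (Step.src (X := X.toTwoPolygraph) ⟨x, α, y⟩) = some w' :=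
      (congrArg (X.words.act k) hL.1).trans hw
    obtain ⟨⟨x', α', y'⟩, h1, -⟩ := X.step_src_isHom.exists_act h0
    exact (congrArg (TopRel X.toTwoPolygraph · []) (congrArg₂ (fun s t => [s, t])
      (total_eq (hl.act_some h1)) (total_eq (hr.act_some h1)))).mpr (.right_inv x' y' α')
  -- Here the sequence starts with `xα⁻y`, whose source is the target of `xαy`, so the action is
  -- lifted through the target map.
  · have h0 : X.words.act k (Step.tgt (X := X.toTwoPolygraph) ⟨x, α, y⟩) = some w' :=
      (congrArg (X.words.act k) hL.1).trans hw
    obtain ⟨⟨x', α', y'⟩, h1, -⟩ := X.step_tgt_isHom.exists_act h0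
    exact (congrArg (TopRel X.toTwoPolygraph · []) (congrArg₂ (fun s t => [s, t])
      (total_eq (hr.act_some h1)) (total_eq (hl.act_some h1)))).mpr (.left_inv x' y' α')

end CrystalTwoPolygraph

/-! ### Inverses of 2-cells in the free (2,1)-monoid. -/

namespace TwoPolygraph

variable {X : TwoPolygraph.{u, v}}

/-- The formal inverse of a step. -/
def Step.inv (s : X.double.Step) : X.double.Step := ⟨s.left, Sum.swap s.gen, s.right⟩

theorem Step.inv_inv (s : X.double.Step) : s.inv.inv = s := by
  obtain ⟨x, α | α, y⟩ := s <;> rfl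

theorem Step.src_inv (s : X.double.Step) : s.inv.src = s.tgt := by
  obtain ⟨x, α | α, y⟩ := s <;> rfl

theorem Step.tgt_inv (s : X.double.Step) : s.inv.tgt = s.src := by
  obtain ⟨x, α | α, y⟩ := s <;> rfl

theorem topRel_inv (s : X.double.Step) : TopRel X [s, s.inv] [] := by
  obtain ⟨x, α | α, y⟩ := s
  · exact .right_inv x y α
  · exact .left_inv x y α

/-- The formal inverse of a list of steps. -/
def invSteps (L : List X.double.Step) : List X.double.Step := (L.map Step.inv).reverse

theorem invSteps_invSteps (L : List X.double.Step) : invSteps (invSteps L) = L := by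
  simp [invSteps, Function.comp_def, Step.inv_inv]

theorem chain_invSteps {w : FreeMonoid X.double.gen₁} {L : List X.double.Step} (h : Chain w L) :
    Chain (endpt w L) (invSteps L) ∧ endpt (endpt w L) (invSteps L) = w := by
  induction L generalizing w with
  | nil => exact ⟨trivial, rfl⟩
  | cons s L ih =>
    obtain ⟨rfl, h2⟩ := h
    obtain ⟨h3, h4⟩ := ih h2
    have e : invSteps (s :: L) = invSteps L ++ [s.inv] := by simp [invSteps]
    rw [e, chain_append, endpt_append]
    change (_ ∧ Chain (endpt (endpt s.tgt L) (invSteps L)) _) ∧ _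
    exact ⟨⟨h3, by rw [h4]; exact ⟨s.src_inv, trivial⟩⟩, s.tgt_inv⟩

/-- The formal inverse of a sequence. -/
def Seq.inv (a : X.double.Seq) : X.double.Seq :=
  ⟨a.tgt, invSteps a.steps, (chain_invSteps a.chain).1⟩

theorem Seq.tgt_inv (a : X.double.Seq) : a.inv.tgt = a.src := (chain_invSteps a.chain).2

theorem Seq.inv_inv (a : X.double.Seq) : a.inv.inv = a :=
  Seq.ext a.tgt_inv (invSteps_invSteps _)

/-- The inner part cancels first, with `s` and `s.inv` absorbed into the context; one inverse
relation then removes this pair. The general context `p`, `q` is what makes the induction work. -/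
theorem cancel_steps (w : FreeMonoid X.double.gen₁) (p L q : List X.double.Step)
    (h : Chain w (p ++ (L ++ invSteps L) ++ q)) : ∃ h' : Chain w (p ++ q),
      Cell.mk X.topRelations ⟨w, _, h⟩ = Cell.mk X.topRelations ⟨w, _, h'⟩ := by
  induction L generalizing p q with
  | nil =>
    refine ⟨by simpa [invSteps] using h, congrArg _ (Seq.ext rfl ?_)⟩
    simp [invSteps]
  | cons s L ih =>
    have e : p ++ (s :: L ++ invSteps (s :: L)) ++ q =
        (p ++ [s]) ++ (L ++ invSteps L) ++ ([s.inv] ++ q) := by simp [invSteps]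
    have h1 := h
    rw [e] at h1
    obtain ⟨h2, e2⟩ := ih _ _ h1
    have h3 : Chain w (p ++ [s, s.inv] ++ q) := by simpa using h2
    have h4 : Chain w (p ++ [] ++ q) := by
      rw [chain_append, chain_append, endpt_append] at h3 ⊢
      refine ⟨⟨h3.1.1, trivial⟩, ?_⟩
      have h5 := h3.2
      change Chain s.inv.tgt q at h5
      rw [Step.tgt_inv, h3.1.2.1] at h5
      exact h5
    refine ⟨by simpa using h4, ?_⟩
    calc Cell.mk X.topRelations ⟨w, _, h⟩
        = Cell.mk X.topRelations ⟨w, _, h1⟩ := congrArg _ (Seq.ext rfl e)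
      _ = Cell.mk X.topRelations ⟨w, _, h2⟩ := e2
      _ = Cell.mk X.topRelations ⟨w, _, h3⟩ := congrArg _ (Seq.ext rfl (by simp))
      _ = Cell.mk X.topRelations ⟨w, _, h4⟩ :=
        Cell.sound ⟨rfl, p, _, _, q, topRel_inv s, rfl, rfl⟩
      _ = Cell.mk X.topRelations ⟨w, p ++ q, by simpa using h4⟩ :=
        congrArg _ (Seq.ext rfl (by simp))

theorem vcomp_inv (a : X.double.Seq) :
    Cell.vcomp (Cell.mk X.topRelations a) (Cell.mk X.topRelations a.inv) rfl =
      Cell.mk X.topRelations (Seq.id a.src) := by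
  have e : (Seq.vcomp a a.inv rfl).steps = [] ++ (a.steps ++ invSteps a.steps) ++ [] := by
    simp [Seq.vcomp, Seq.inv]
  obtain ⟨_, h⟩ := cancel_steps a.src [] a.steps [] (e ▸ (Seq.vcomp a a.inv rfl).chain)
  have e' : Seq.vcomp a a.inv rfl = ⟨a.src, _, e ▸ (Seq.vcomp a a.inv rfl).chain⟩ := Seq.ext rfl e
  exact (Cell.vcomp_mk a a.inv rfl).trans ((congrArg (Cell.mk _) e').trans h)

theorem freeTop_isTwoOneMonoid (X : TwoPolygraph.{u, v}) : X.freeTop.IsTwoOneMonoid := by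
  rintro ⟨a⟩
  refine ⟨Cell.mk X.topRelations a.inv, rfl, a.tgt_inv, vcomp_inv a, ?_⟩
  -- Formal inversion is involutive, so the second inverse law is the first one for `a.inv`.
  have h := vcomp_inv a.inv
  simp only [Seq.inv_inv] at h
  exact h

end TwoPolygraph

theorem mainTheorem6 {I P Pv : Type*} [AddCommGroup P] [AddCommGroup Pv]
    (D : CartanDatum I P Pv) (X : CrystalTwoPolygraph.{u, v} D) :
    (∃ S : CrystalTwoMonoid D X.free,
      S.one = X.crystal₁.word ∧
      Crystal.IsHom S.one S.two X.free.id ∧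
      Crystal.IsHom X.crystal₂ S.two (fun α => X.exchangeRelations.gen α) ∧
      (X.crystal₁.InGCryst → X.crystal₂.InGCryst → S.InGCryst)) ∧
    X.freeTop.IsTwoOneMonoid ∧
    (∃ S : CrystalTwoMonoid D X.freeTop,
      S.one = X.crystal₁.word ∧
      Crystal.IsHom S.one S.two X.freeTop.id ∧
      Crystal.IsHom X.crystal₂ S.two (fun α => X.topRelations.gen (Sum.inl α)) ∧
      Crystal.IsHom X.crystal₂ S.two (fun α => X.topRelations.gen (Sum.inr α)) ∧
      (X.crystal₁.InGCryst → X.crystal₂.InGCryst → S.InGCryst)) := by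
  refine ⟨CrystalTwoPolygraph.exists_crystalTwoMonoid X.exchangeRelations_isStable,
    X.freeTop_isTwoOneMonoid, ?_⟩
  -- The general construction is applied to `X.double`; its generators form a disjoint union, whose
  -- two inclusions give `α` and `α⁻`.
  obtain ⟨S, h1, h2, h3, h4⟩ :=
    CrystalTwoPolygraph.exists_crystalTwoMonoid X.topRelations_isStable
  exact ⟨S, h1, h2, h3.comp Crystal.sum_inl_isHom, h3.comp Crystal.sum_inr_isHom,
    fun h5 h6 => h4 h5 h6.sum_self⟩
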